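/- For integers $1\le r\le n$ let $B_{r,n}(z)=\sum_{k=0}^{r}\binom{n}{k}z^k$, and for $0<\alpha<1$ let $K_\alpha=\alpha^\alpha(1-\alpha)^{1-\alpha}$ and $$C_\alpha=\Bigl\{z\in\mathbb C:\ \frac{|z|^\alpha}{|1+z|}=K_\alpha,\ |z|\le\frac{\alpha}{1-\alpha}\Bigr\}.$$ Let $\operatorname{erfc}(z)=\frac{2}{\sqrt\pi}\int_z^{\infty}e^{-s^2}\,ds$ be the complementary error function on $\mathbb C$ (the path of integration being the horizontal ray from $z$ to $+\infty$). Fix $0<\delta<1$. 1. There are a constant $c$ and a threshold $N$, depending only on $\delta$, such that for all $r,n\ge N$ with $\delta<\frac rn<1-\delta$ and every zero $z^*$ of $B_{r,n}$ $$\min_{\zeta\in C_{r/n}}|z^*-\zeta|\le\frac{c}{\bigl|z^*-\frac{r}{n-r}\bigr|}\cdot\frac{\ln n}{n},$$ the minimum being attained. 2. There are a constant $C$ and a threshold $N$, depending only on $\delta$, such that for all $r,n\ge N$ with $\delta<\frac rn<1-\delta$ the polynomial $B_{r,n}$ has a zero $z^*$ with $\bigl|z^*-\frac{r}{n-r}\bigr|\le\frac{C}{\sqrt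 n}$. 3. Such zeros are located by the zeros of $\operatorname{erfc}$: for every $\chi\in\mathbb C$ with $\operatorname{erfc}(\chi)=0$ and every $\varepsilon>0$ there is $N$, depending only on $\delta,\chi,\varepsilon$, such that for all $r,n\ge N$ with $\delta<\frac rn<1-\delta$, writing $\beta=r/n$, the polynomial $B_{r,n}$ has a zero $z^*$ with $$\Bigl|z^*-\Bigl(\frac{\beta}{1-\beta}+\sqrt{\frac{2\beta}{(1-\beta)^3}}\cdot\frac{\chi}{\sqrt n}\Bigr)\Bigr|\le\frac{\varepsilon}{\sqrt n}.$$ -/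

import Mathlib

open Real Set MeasureTheory

/-- The section `B_{r,n}(z) = ∑_{k=0}^{r} (n choose k) z^k` of the binomial expansion
of `(1 + z)^n`. -/
noncomputable def binomSection (r n : ℕ) (z : ℂ) : ℂ :=
  ∑ k ∈ Finset.range (r + 1), (n.choose k : ℂ) * z ^ k

/-- The constant `K_α = α^α (1 - α)^(1 - α)`. -/
noncomputable def curveConst (α : ℝ) : ℝ :=
  α ^ α * (1 - α) ^ (1 - α)

/-- The curve `C_α = {z : |z|^α / |1 + z| = K_α, |z| ≤ α / (1 - α)}`, for `0 < α < 1`.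
At `z = -1` the quotient below is `0 ≠ K_α`, so that this point is excluded. -/
def limitCurve (α : ℝ) : Set ℂ :=
  {z : ℂ | ‖z‖ ^ α / ‖1 + z‖ = curveConst α ∧ ‖z‖ ≤ α / (1 - α)}

/-- The complementary error function `erfc z = (2 / √π) ∫_z^∞ exp (-s²) ds` on the complex
plane, the integral being taken along the horizontal ray `s = z + t`, `t > 0`. -/
noncomputable def complexErfc (z : ℂ) : ℂ :=
  (2 / √π : ℝ) * ∫ t : ℝ in Ioi 0, Complex.exp (-(z + (t : ℂ)) ^ 2)

/-!
With `u = z / (1 + z)` and `α = r / n`, the polynomial `B_{r,n}(z) / (1 + z)^n` becomes the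
distribution function `F(u) = ∑_{k ≤ r} (n choose k) u^k (1 - u)^(n - k)` of the binomial law, and the
limit curve becomes the lobe around `0` of the lemniscate `H(u) = 0`, where
`H(u) = α log ‖u‖ + (1 - α) log ‖1 - u‖ - α log α - (1 - α) log (1 - α)` (`levelFn`). Its corner is
the saddle point `u = α` of `u^α (1 - u)^(1 - α)`, which corresponds to `z = r / (n - r)`.

**Distance to the curve.** At a zero `z` of `B_{r,n}` the upper part of the binomial expansion gives
`(1 + z)^n = z^(r+1) Q(z)` with `Q(z) = ∑_j (n choose r+1+j) z^j`. An Eneström–Kakeya estimate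
(`mul_one_sub_norm_le_norm_sum`) bounds the zeros by `1 / n ≤ ‖z‖ ≤ r / (n - r + 1)`, and, applied
once more to `Q` on this slightly smaller disc, shows that `‖Q(z)‖` is, up to powers of `n`, its
leading coefficient. Taking logarithms, `|H(u)| ≤ 7 log n / n` at every zero
(`abs_levelFn_le_of_binomSection_eq_zero`). A geometric statement, uniform in
`α`, turns this into a distance: a point `u` on the relevant side with `H(u)` small has a point `v`
of the lobe with `‖u - v‖ ‖u - α‖ ≤ c |H(u)|` (`exists_levelFn_eq_zero_near`). For `‖u‖ > α` one takes
`v = α`; for `Re u ≤ 0` one moves along the ray through `0`; otherwise one moves along the circle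
`‖v‖ = ‖u‖`, on which `‖1 - u‖² - ‖1 - v‖² = 2 (Re v - Re u)`.

**Zeros near the corner.** Since `F'(u) = -(n - r) (n choose r) u^r (1 - u)^(n - r - 1)`, Stirling's
formula shows that on the scale `u = α + x √(2 α (1 - α) / n)` the derivative converges to
`-exp (-x²) / √π`, uniformly on bounded sets and in `α`. Chebyshev's inequality makes `F` small at a
large positive `x`, where `erfc` is small as well; integrating from there, the rescaled `F` converges
to `erfc / 2` (`eventually_norm_rescaledCDF_sub_le`), and Hurwitz's argument transfers the zeros of
`erfc` to `F` (`eventually_exists_zero_near`). Finally `erfc` has a zero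
(`exists_complexErfc_eq_zero`): otherwise `erfc = exp p` up to a constant, with `p` a polynomial of
degree at most two by the Borel–Carathéodory theorem, and `exp (-z²)` would be an affine multiple of
`erfc`.
-/

section

open Filter Topology

/-! ### The complementary error function on the complex plane -/

/-- The complementary error function through a primitive `E` of `exp (-z²)`: the limit of `E` along
horizontal rays does not depend on the ray, because `E (z + t) - E t` tends to `0`. -/
theorem complexErfc_eq_of_primitive {E : ℂ → ℂ} (hE : ∀ z, HasDerivAt E (Complex.exp (-z ^ 2)) z) :
    ∃ L : ℂ, Tendsto (fun t : ℝ => E t) atTop (𝓝 L) ∧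
      ∀ z, complexErfc z = (2 / √π : ℝ) * (L - E z) := by
  have hint : ∀ z : ℂ, Integrable (fun t : ℝ => Complex.exp (-(z + (t : ℂ)) ^ 2)) := by
    intro z
    have := integrable_cexp_quadratic (b := 1) (by simp) (-2 * z) (-z ^ 2)
    refine this.congr (Eventually.of_forall fun t => ?_)
    simp only
    congr 1
    ring
  have hder : ∀ (z : ℂ) (t : ℝ), HasDerivAt (fun t : ℝ => E (z + t))
      (Complex.exp (-(z + (t : ℂ)) ^ 2)) t := by
    intro z t
    have h1 : HasDerivAt (fun w : ℂ => E (z + w)) (Complex.exp (-(z + (t : ℂ)) ^ 2)) (t : ℂ) := by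
      simpa using (hE (z + t)).comp_const_add z (t : ℂ)
    exact h1.comp_ofReal
  have hlim : ∀ z : ℂ, ∃ L, Tendsto (fun t : ℝ => E (z + t)) atTop (𝓝 L) := by
    intro z
    exact ⟨_, tendsto_limUnder_of_hasDerivAt_of_integrableOn_Ioi (a := 0)
      (fun t _ => hder z t) (hint z).integrableOn⟩
  obtain ⟨L, hL⟩ := hlim 0
  simp only [zero_add] at hL
  refine ⟨L, hL, fun z => ?_⟩
  have hdiff : Tendsto (fun t : ℝ => E (z + t) - E t) atTop (𝓝 0) := by
    have hb : ∀ᶠ t : ℝ in atTop, ‖E (z + t) - E t‖ ≤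
        Real.exp (‖z‖ ^ 2 - (t - ‖z‖) ^ 2) * ‖z‖ := by
      filter_upwards [eventually_ge_atTop ‖z‖] with t ht
      have := (convex_segment (𝕜 := ℝ) (t : ℂ) (z + t)).norm_image_sub_le_of_norm_hasDerivWithin_le
        (f := E) (f' := fun w => Complex.exp (-w ^ 2))
        (C := Real.exp (‖z‖ ^ 2 - (t - ‖z‖) ^ 2))
        (fun w _ => (hE w).hasDerivWithinAt) ?_ (left_mem_segment ℝ _ _)
        (right_mem_segment ℝ _ _)
      · simpa using this
      · intro w hw
        rw [segment_eq_image'] at hw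
        obtain ⟨s, ⟨hs0, hs1⟩, rfl⟩ := hw
        rw [Complex.norm_exp]
        apply Real.exp_le_exp.2
        have h1 := Complex.abs_re_le_norm z
        have h2 := Complex.abs_im_le_norm z
        have h3 : ((-((t : ℂ) + s • (z + t - t)) ^ 2).re) = (s * z.im) ^ 2 - (t + s * z.re) ^ 2 := by
          simp [pow_two]
        rw [h3]
        have h4 : (s * z.im) ^ 2 ≤ ‖z‖ ^ 2 := by
          rw [sq_le_sq, abs_mul, abs_of_nonneg hs0, abs_of_nonneg (norm_nonneg z)]
          nlinarith [abs_nonneg z.im]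
        have h5 : (t - ‖z‖) ≤ (t + s * z.re) := by
          have := neg_abs_le z.re
          nlinarith [abs_nonneg z.re]
        nlinarith [sub_nonneg.2 ht]
    refine squeeze_zero_norm' hb ?_
    rw [← zero_mul ‖z‖]
    refine Tendsto.mul_const _ (Real.tendsto_exp_atBot.comp ?_)
    apply tendsto_atBot_add_const_left
    apply tendsto_neg_atTop_atBot.comp
    exact (tendsto_pow_atTop two_ne_zero).comp (tendsto_atTop_add_const_right _ _ tendsto_id)
  have hz : Tendsto (fun t : ℝ => E (z + t)) atTop (𝓝 L) := by
    simpa using hdiff.add hL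
  have := integral_Ioi_of_hasDerivAt_of_tendsto' (a := 0) (fun t _ => hder z t)
    (hint z).integrableOn hz
  rw [complexErfc, this]
  simp

theorem exists_primitive_exp_neg_sq :
    ∃ E : ℂ → ℂ, ∀ z, HasDerivAt E (Complex.exp (-z ^ 2)) z := by
  have h : Differentiable ℂ fun z : ℂ => Complex.exp (-z ^ 2) := by fun_prop
  obtain ⟨E, hE⟩ := h.isExactOn_univ
  exact ⟨E, fun z => hE z (mem_univ z)⟩

theorem hasDerivAt_complexErfc (z : ℂ) :
    HasDerivAt complexErfc (-((2 / √π : ℝ) * Complex.exp (-z ^ 2))) z := by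
  obtain ⟨E, hE⟩ := exists_primitive_exp_neg_sq
  obtain ⟨L, -, h⟩ := complexErfc_eq_of_primitive hE
  rw [funext h]
  simpa using ((hE z).const_sub L).const_mul ((2 / √π : ℝ) : ℂ)

theorem tendsto_complexErfc_atTop :
    Tendsto (fun t : ℝ => complexErfc t) atTop (𝓝 0) := by
  obtain ⟨E, hE⟩ := exists_primitive_exp_neg_sq
  obtain ⟨L, hL, h⟩ := complexErfc_eq_of_primitive hE
  simp only [h]
  simpa using (hL.const_sub L).const_mul ((2 / √π : ℝ) : ℂ)

theorem norm_complexErfc_le (z : ℂ) : ‖complexErfc z‖ ≤ 2 * Real.exp (‖z‖ ^ 2) := by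
  have hpi : 0 < √π := by positivity
  have hg : Integrable (fun t : ℝ => Real.exp (z.im ^ 2) * Real.exp (-1 * (z.re + t) ^ 2)) :=
    ((integrable_exp_neg_mul_sq one_pos).comp_add_left z.re).const_mul _
  have h1 : ‖∫ t : ℝ in Ioi 0, Complex.exp (-(z + (t : ℂ)) ^ 2)‖ ≤
      Real.exp (z.im ^ 2) * √π := by
    calc _ ≤ ∫ t : ℝ in Ioi 0, Real.exp (z.im ^ 2) * Real.exp (-1 * (z.re + t) ^ 2) := by
          refine norm_integral_le_of_norm_le hg.integrableOn
            (Filter.Eventually.of_forall fun t => ?_)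
          rw [Complex.norm_exp, ← Real.exp_add]
          apply Real.exp_le_exp.2
          simp [pow_two]
      _ ≤ ∫ t : ℝ, Real.exp (z.im ^ 2) * Real.exp (-1 * (z.re + t) ^ 2) :=
          setIntegral_le_integral hg (Filter.Eventually.of_forall fun t => by positivity)
      _ = _ := by
          rw [integral_const_mul,
            integral_add_left_eq_self (fun t : ℝ => Real.exp (-1 * t ^ 2)) z.re,
            integral_gaussian]
          simp
  rw [complexErfc, norm_mul, Complex.norm_real, Real.norm_of_nonneg (by positivity)]
  calc _ ≤ 2 / √π * (Real.exp (z.im ^ 2) * √π) := by gcongr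
    _ = 2 * Real.exp (z.im ^ 2) := by field_simp
    _ ≤ _ := by
      have := Complex.abs_im_le_norm z
      have h2 : z.im ^ 2 ≤ ‖z‖ ^ 2 := by
        rw [← sq_abs z.im]
        gcongr
      gcongr

/-- An entire function of at most quadratic growth is a polynomial of degree at most two, so that its
derivative is affine. -/
theorem exists_deriv_eq_affine_of_quadratic_growth {p : ℂ → ℂ} (hp : Differentiable ℂ p) {A : ℝ}
    (hA : ∀ z, ‖p z‖ ≤ A * (1 + ‖z‖ ^ 2)) : ∃ a b : ℂ, ∀ z, deriv p z = a + b * z := by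
  have h3 : ∀ c, iteratedDeriv 3 p c = 0 := by
    intro c
    have hb : ∀ R : ℝ, 1 ≤ R → ‖iteratedDeriv 3 p c‖ ≤ (6 * A * (1 + (‖c‖ + 1) ^ 2)) * R⁻¹ := by
      intro R hR
      have hA0 : 0 ≤ A := by
        have := (norm_nonneg _).trans (hA 0)
        simpa using this
      have := Complex.norm_iteratedDeriv_le_of_forall_mem_sphere_norm_le 3
        (C := A * (1 + (‖c‖ + 1) ^ 2) * R ^ 2) (f := p) (c := c)
        (by linarith : (0 : ℝ) < R) hp.diffContOnCl ?_
      · refine this.trans (le_of_eq ?_)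
        have : R ≠ 0 := by positivity
        norm_num [Nat.factorial]
        field_simp
      · intro z hz
        refine (hA z).trans ?_
        have h1 : ‖z‖ ≤ ‖c‖ + R := by
          rw [mem_sphere_iff_norm] at hz
          calc ‖z‖ = ‖c + (z - c)‖ := by ring_nf
            _ ≤ _ := by rw [← hz]; exact norm_add_le _ _
        have h2 : ‖z‖ ≤ (‖c‖ + 1) * R := by nlinarith [norm_nonneg c]
        have h3 : ‖z‖ ^ 2 ≤ (‖c‖ + 1) ^ 2 * R ^ 2 := by
          rw [← mul_pow]; gcongr
        rw [mul_assoc]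
        gcongr
        nlinarith
    have hlim : Filter.Tendsto (fun R : ℝ => (6 * A * (1 + (‖c‖ + 1) ^ 2)) * R⁻¹) Filter.atTop
        (nhds 0) := by
      have := (tendsto_inv_atTop_zero (𝕜 := ℝ)).const_mul (6 * A * (1 + (‖c‖ + 1) ^ 2))
      rwa [mul_zero] at this
    have := ge_of_tendsto hlim (Filter.eventually_atTop.2 ⟨1, hb⟩)
    simpa using this
  have hd : Differentiable ℂ (deriv p) := hp.deriv
  have hdd : Differentiable ℂ (deriv (deriv p)) := hd.deriv
  have h2 : ∀ z, deriv (deriv p) z = deriv (deriv p) 0 := fun z =>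
    is_const_of_deriv_eq_zero hdd (fun c => by
      have := h3 c
      rwa [iteratedDeriv_succ, iteratedDeriv_succ, iteratedDeriv_one] at this) z 0
  refine ⟨deriv p 0, deriv (deriv p) 0, fun z => ?_⟩
  have h4 := is_const_of_deriv_eq_zero
    (f := fun z => deriv p z - deriv (deriv p) 0 * z) (by fun_prop) (fun c => by
      rw [deriv_fun_sub (hd c) (by fun_prop), h2 c]
      simp) z 0
  simp only [mul_zero, sub_zero] at h4
  rw [← h4]; ring

/-- The complementary error function has a zero: a zero-free `erfc` of order two would be
`c exp p` with `p'` affine, so that `-(2 / √π) exp (-z²) = p' erfc`. As the left side does not vanish,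
`p'` is constant, and then `erfc` is a multiple of `exp (-z²)`, whose logarithmic derivative is not
constant. -/
theorem exists_complexErfc_eq_zero : ∃ χ : ℂ, complexErfc χ = 0 := by
  by_contra! hne
  have hdiff : Differentiable ℂ complexErfc := fun z => (hasDerivAt_complexErfc z).differentiableAt
  have hd : Differentiable ℂ fun z => deriv complexErfc z / complexErfc z :=
    hdiff.deriv.div hdiff hne
  obtain ⟨p, hp⟩ := hd.isExactOn_univ
  replace hp := fun z => hp z (mem_univ z)
  have hpd : Differentiable ℂ p := fun z => (hp z).differentiableAt
  -- the quotient `erfc / exp p` is a nonzero constant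
  have hconst : ∀ z, complexErfc z * Complex.exp (-p z) = complexErfc 0 * Complex.exp (-p 0) := by
    intro z
    refine is_const_of_deriv_eq_zero
      (f := fun z => complexErfc z * Complex.exp (-p z)) (by fun_prop) (fun c => ?_) z 0
    have := ((hdiff c).hasDerivAt.mul (hp c).neg.cexp).deriv
    refine Eq.trans this ?_
    have := hne c
    field_simp
    ring
  set c := complexErfc 0 * Complex.exp (-p 0) with hc
  have hc0 : c ≠ 0 := mul_ne_zero (hne 0) (Complex.exp_ne_zero _)
  have hre : ∀ z, (p z).re ≤ |Real.log (2 / ‖c‖)| + ‖z‖ ^ 2 := by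
    intro z
    have h1 : complexErfc z = c * Complex.exp (p z) := by
      rw [← hconst z, mul_assoc, ← Complex.exp_add]; simp
    have h2 := norm_complexErfc_le z
    rw [h1, norm_mul, Complex.norm_exp] at h2
    have hcp : 0 < ‖c‖ := norm_pos_iff.2 hc0
    have h3 : Real.exp (p z).re ≤ 2 / ‖c‖ * Real.exp (‖z‖ ^ 2) := by
      rw [div_mul_eq_mul_div, le_div_iff₀ hcp]; linarith
    have h4 := Real.log_le_log (Real.exp_pos _) h3
    rw [Real.log_exp, Real.log_mul (by positivity) (by positivity), Real.log_exp] at h4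
    linarith [le_abs_self (Real.log (2 / ‖c‖))]
  set l := |Real.log (2 / ‖c‖)| with hl
  have hl0 : 0 ≤ l := abs_nonneg _
  have hgrowth : ∀ z, ‖p z‖ ≤ (2 * l + 8 + 3 * ‖p 0‖) * (1 + ‖z‖ ^ 2) := by
    intro z
    have hz := norm_nonneg z
    have hR : 0 < 2 * ‖z‖ + 1 := by positivity
    have hBC := Complex.borelCaratheodory (f := p) (R := 2 * ‖z‖ + 1) (z := z)
      (M := l + (2 * ‖z‖ + 1) ^ 2) (by positivity) hpd.differentiableOn (fun w hw => by
        have hw' : ‖w‖ ≤ 2 * ‖z‖ + 1 := (mem_ball_zero_iff.1 hw).le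
        have : ‖w‖ ^ 2 ≤ (2 * ‖z‖ + 1) ^ 2 := by gcongr
        exact (hre w).trans (by linarith)) hR (by
        rw [mem_ball_zero_iff]; linarith)
    refine hBC.trans ?_
    rw [← add_div, div_le_iff₀ (by linarith)]
    have h0 := norm_nonneg (p 0)
    have e : 2 * ‖z‖ + 1 - ‖z‖ = ‖z‖ + 1 := by ring
    rw [e]
    generalize ‖z‖ = x at *
    generalize ‖p 0‖ = y at *
    have hx3 : 0 ≤ x ^ 3 := by positivity
    have hx2 : 0 ≤ x ^ 2 := by positivity
    nlinarith [mul_nonneg hl0 hx3, mul_nonneg hl0 hx2, mul_nonneg hl0 hz, mul_nonneg h0 hx3,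
      mul_nonneg h0 hx2, mul_nonneg h0 hz, mul_nonneg hz (sq_nonneg (x - 1)), sq_nonneg (x - 1)]
  obtain ⟨a, b, hab⟩ := exists_deriv_eq_affine_of_quadratic_growth hpd hgrowth
  have hpi : ((2 / √π : ℝ) : ℂ) ≠ 0 := by
    have : (2 / √π : ℝ) ≠ 0 := by positivity
    exact_mod_cast this
  have key : ∀ z, -((2 / √π : ℝ) * Complex.exp (-z ^ 2)) = (a + b * z) * complexErfc z := by
    intro z
    rw [← hab z, (hp z).deriv]
    beta_reduce
    rw [(hasDerivAt_complexErfc z).deriv, div_mul_cancel₀ _ (hne z)]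
  have hne' : ∀ z, a + b * z ≠ 0 := fun z hz => by
    have := key z
    rw [hz, zero_mul, neg_eq_zero] at this
    exact mul_ne_zero hpi (Complex.exp_ne_zero _) this
  have hb : b = 0 := by
    by_contra hb
    exact hne' (-a / b) (by field_simp; ring)
  subst hb
  -- now `erfc` is a multiple of `exp (-z²)`, with logarithmic derivative `-2 z` instead of `a`
  have hderiv : ∀ z, -(2 * z) = a := by
    intro z
    have h1 : HasDerivAt (fun z => -((2 / √π : ℝ) * Complex.exp (-z ^ 2)))
        (-((2 / √π : ℝ) * (Complex.exp (-z ^ 2) * (-(2 * z))))) z := by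
      have := ((((hasDerivAt_pow 2 z).fun_neg).cexp).const_mul ((2 / √π : ℝ) : ℂ)).fun_neg
      simpa using this
    have h2 : HasDerivAt (fun z => -((2 / √π : ℝ) * Complex.exp (-z ^ 2)))
        (a * -((2 / √π : ℝ) * Complex.exp (-z ^ 2))) z := by
      have := (hasDerivAt_complexErfc z).const_mul a
      refine this.congr_of_eventuallyEq (Filter.Eventually.of_forall fun w => ?_)
      simpa using key w
    have h3 := h1.unique h2
    have h4 := mul_ne_zero hpi (Complex.exp_ne_zero (-z ^ 2))
    apply mul_left_cancel₀ h4
    linear_combination -h3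
  have h0 := hderiv 0
  have h1 := hderiv 1
  rw [← h0] at h1
  norm_num at h1

/-! ### The binomial distribution function of a complex argument -/

/-- The probability of at most `r` successes in `n` trials, as a polynomial in the success
probability `u`, extended to complex `u`. -/
noncomputable def binomCDF (r n : ℕ) (u : ℂ) : ℂ :=
  ∑ k ∈ Finset.range (r + 1), (n.choose k : ℂ) * u ^ k * (1 - u) ^ (n - k)

theorem binomCDF_eq {r n : ℕ} (hrn : r ≤ n) {u : ℂ} (hu : u ≠ 1) :
    binomCDF r n u = (1 - u) ^ n * binomSection r n (u / (1 - u)) := by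
  have hu' : 1 - u ≠ 0 := sub_ne_zero.2 hu.symm
  rw [binomCDF, binomSection, Finset.mul_sum]
  refine Finset.sum_congr rfl fun k hk => ?_
  have hk' : k ≤ n := by have := Finset.mem_range.1 hk; omega
  obtain ⟨j, rfl⟩ := Nat.exists_eq_add_of_le hk'
  rw [Nat.add_sub_cancel_left, div_pow, pow_add]
  field_simp

theorem hasDerivAt_binomCDF {r m : ℕ} (u : ℂ) :
    HasDerivAt (binomCDF r (r + m + 1))
      (-((m + 1 : ℂ) * ((r + m + 1).choose r : ℂ) * u ^ r * (1 - u) ^ m)) u := by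
  have hterm : ∀ n k : ℕ, HasDerivAt (fun u : ℂ => (n.choose k : ℂ) * u ^ k * (1 - u) ^ (n - k))
      ((n.choose k : ℂ) * ((k : ℂ) * u ^ (k - 1) * (1 - u) ^ (n - k) -
        u ^ k * (((n - k : ℕ) : ℂ) * (1 - u) ^ (n - k - 1)))) u := by
    intro n k
    have h1 := (hasDerivAt_pow k u).const_mul (n.choose k : ℂ)
    have h2 := ((hasDerivAt_id u).const_sub (1 : ℂ)).fun_pow (n - k)
    refine (h1.mul h2).congr_deriv ?_
    simp only [id]
    ring
  induction r generalizing m with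
  | zero =>
    have := hterm (m + 1) 0
    have e : binomCDF 0 (0 + m + 1) = fun u => (1 - u) ^ (m + 1) := by
      funext u
      simp [binomCDF]
    rw [e]
    simpa using this
  | succ r ih =>
    have h1 := ih (m := m + 1)
    have h2 := hterm (r + 1 + m + 1) (r + 1)
    rw [show r + (m + 1) + 1 = r + 1 + m + 1 by ring] at h1
    have hsum : binomCDF (r + 1) (r + 1 + m + 1) = fun u => binomCDF r (r + 1 + m + 1) u +
        ((r + 1 + m + 1).choose (r + 1) : ℂ) * u ^ (r + 1) *
          (1 - u) ^ (r + 1 + m + 1 - (r + 1)) := by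
      funext u
      rw [binomCDF, Finset.sum_range_succ, ← binomCDF]
    rw [hsum]
    refine (h1.add h2).congr_deriv ?_
    have hch : ((r + 1 + m + 1).choose (r + 1) : ℂ) * (r + 1) =
        ((r + 1 + m + 1).choose r : ℂ) * (m + 2) := by
      have := Nat.choose_succ_right_eq (r + 1 + m + 1) r
      rw [show r + 1 + m + 1 - r = m + 2 by omega] at this
      exact_mod_cast this
    rw [show r + 1 + m + 1 - (r + 1) = m + 1 by omega]
    simp only [Nat.add_sub_cancel]
    push_cast
    linear_combination (u ^ r * (1 - u) ^ (m + 1)) * hch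

theorem differentiable_binomCDF (r n : ℕ) : Differentiable ℂ (binomCDF r n) := by
  unfold binomCDF
  fun_prop

/-- Chebyshev's inequality: for a success probability `u > r / n` it is unlikely to have at most `r`
successes. -/
theorem norm_binomCDF_le {r n : ℕ} (hrn : r ≤ n) (hn : 0 < n) {u : ℝ} (hu1 : u ≤ 1)
    (hu : (r : ℝ) / n < u) : ‖binomCDF r n u‖ ≤ 1 / (4 * (n * (u - r / n) ^ 2)) := by
  have hn' : (0 : ℝ) < n := by exact_mod_cast hn
  have hu0 : 0 ≤ u := le_trans (by positivity) hu.le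
  have hd : 0 < u - r / n := sub_pos.2 hu
  set b : ℕ → ℝ := fun k => (n.choose k : ℝ) * u ^ k * (1 - u) ^ (n - k) with hb
  have hb0 : ∀ k, 0 ≤ b k := fun k => by
    have : 0 ≤ 1 - u := by linarith
    positivity
  have hnorm : binomCDF r n u = ((∑ k ∈ Finset.range (r + 1), b k : ℝ) : ℂ) := by
    simp [binomCDF, hb]
  have hnn : 0 ≤ ∑ k ∈ Finset.range (r + 1), b k := Finset.sum_nonneg fun k _ => hb0 k
  rw [hnorm, Complex.norm_real, Real.norm_of_nonneg hnn]
  have hvar : ∑ k ∈ Finset.range (n + 1), (n * u - k) ^ 2 * b k = n * u * (1 - u) := by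
    have := congrArg (Polynomial.eval u) (bernsteinPolynomial.variance ℝ n)
    simpa [Polynomial.eval_finsetSum, bernsteinPolynomial, hb, mul_assoc] using this
  have h1 : (n * (u - r / n)) ^ 2 * ∑ k ∈ Finset.range (r + 1), b k ≤ n * u * (1 - u) := by
    rw [← hvar, Finset.mul_sum]
    refine (Finset.sum_le_sum fun k hk => ?_).trans
      (Finset.sum_le_sum_of_subset_of_nonneg (Finset.range_mono (by omega)) fun k _ _ =>
        mul_nonneg (sq_nonneg _) (hb0 k))
    refine mul_le_mul_of_nonneg_right ?_ (hb0 k)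
    have hk : (k : ℝ) ≤ r := by exact_mod_cast Nat.lt_succ_iff.1 (Finset.mem_range.1 hk)
    have h2 : (n : ℝ) * (u - r / n) = n * u - r := by field_simp
    have h3 : 0 < (n : ℝ) * (u - r / n) := by positivity
    rw [h2] at h3 ⊢
    gcongr
  rw [le_div_iff₀ (by positivity)]
  have h2 : u * (1 - u) ≤ 1 / 4 := by nlinarith [sq_nonneg (u - 1 / 2)]
  have h4 : n * ((∑ k ∈ Finset.range (r + 1), b k) * (n * (u - r / n) ^ 2)) ≤ n * (1 / 4) :=
    calc _ = (n * (u - r / n)) ^ 2 * ∑ k ∈ Finset.range (r + 1), b k := by ring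
      _ ≤ n * (u * (1 - u)) := by linarith
      _ ≤ _ := by gcongr
  have h5 := le_of_mul_le_mul_left h4 hn'
  linarith

theorem stirlingSeq_pos {n : ℕ} (hn : 0 < n) : 0 < Stirling.stirlingSeq n := by
  obtain ⟨k, rfl⟩ := Nat.exists_eq_succ_of_ne_zero hn.ne'
  exact Stirling.stirlingSeq'_pos k

/-- In the normalization of the local limit theorem the modal binomial probability is exactly a quotient
of the sequences `k! / (√(2 k) (k / e)^k)`. -/
theorem sqrt_mul_choose_mul_eq_stirlingSeq {r m n : ℕ} (hr : 0 < r) (hm : 0 < m)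
    (hn : n = r + m) :
    √(2 * (r / n) * (m / n)) * √n * (n.choose r * (r / n : ℝ) ^ r * (m / n : ℝ) ^ m) =
      Stirling.stirlingSeq n / (Stirling.stirlingSeq r * Stirling.stirlingSeq m) := by
  have hr' : (0 : ℝ) < r := by exact_mod_cast hr
  have hm' : (0 : ℝ) < m := by exact_mod_cast hm
  have hn' : (0 : ℝ) < n := by rw [hn]; positivity
  have hs : √(2 * (r / n) * (m / n)) * √(n : ℝ) = √(2 * r) * √(2 * m) / √(2 * n) := by
    rw [← Real.sqrt_mul (by positivity), ← Real.sqrt_mul (by positivity),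
      ← Real.sqrt_div (by positivity)]
    congr 1
    field_simp
  have hc : (n.choose r : ℝ) = n.factorial / (r.factorial * m.factorial) := by
    rw [Nat.cast_choose ℝ (by omega), show n - r = m by omega]
  rw [hs, hc]
  simp only [Stirling.stirlingSeq]
  have e1 : (n / Real.exp 1) ^ n = (n / Real.exp 1) ^ r * (n / Real.exp 1 : ℝ) ^ m := by
    rw [← pow_add, hn]
  rw [e1]
  have h1 : (0 : ℝ) < r.factorial := by positivity
  have h2 : (0 : ℝ) < m.factorial := by positivity
  simp only [div_pow]
  field_simp

/-- Second-order expansion of `r log (1 + a) + m log (1 - b)`: the hypotheses say that the linear terms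
cancel and that the quadratic terms sum up to `-x²`, while `T` bounds the remainder. The factor
`1 - b` missing from the exponent `m + 1` contributes the term `2 ‖b‖`. -/
theorem norm_one_add_pow_mul_sub_exp_le {r m : ℕ} {a b x : ℂ} {T : ℝ} (ha : ‖a‖ ≤ 1 / 2)
    (hb : ‖b‖ ≤ 1 / 2) (h1 : (r : ℂ) * a = (m + 1) * b)
    (h2 : (r : ℂ) * a ^ 2 + (m + 1) * b ^ 2 = 2 * x ^ 2)
    (hT : r * ‖a‖ ^ 3 + (m + 1) * ‖b‖ ^ 3 + 2 * ‖b‖ ≤ T) (hT1 : T ≤ 1) :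
    ‖(1 + a) ^ r * (1 - b) ^ m - Complex.exp (-x ^ 2)‖ ≤ Real.exp (‖x‖ ^ 2) * (2 * T) := by
  have hlog : ∀ z : ℂ, ‖z‖ ≤ 1 / 2 → 1 + z ≠ 0 ∧
      ‖Complex.log (1 + z) - (z - z ^ 2 / 2)‖ ≤ ‖z‖ ^ 3 := by
    intro z hz
    have hz1 : ‖z‖ < 1 := by linarith
    refine ⟨fun h => ?_, ?_⟩
    · have : z = -1 := by linear_combination h
      rw [this] at hz1
      simp at hz1
    · have h := Complex.norm_log_sub_logTaylor_le 2 hz1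
      have e : Complex.logTaylor (2 + 1) z = z - z ^ 2 / 2 := by
        simp [Complex.logTaylor, Finset.sum_range_succ]
        ring
      rw [e] at h
      refine h.trans ?_
      have h3 : (1 - ‖z‖)⁻¹ ≤ 2 := by
        rw [inv_le_comm₀ (by linarith) (by norm_num)]
        linarith
      norm_num
      have h4 : 0 ≤ ‖z‖ ^ 3 := by positivity
      nlinarith
  obtain ⟨ha0, ha3⟩ := hlog a ha
  obtain ⟨hb0, hb3⟩ := hlog (-b) (by rwa [norm_neg])
  rw [norm_neg] at hb3
  have hb4 : ‖Complex.log (1 + -b)‖ ≤ 2 * ‖b‖ := by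
    have := Complex.norm_log_one_add_half_le_self (z := -b) (by rwa [norm_neg])
    rw [norm_neg] at this
    linarith [norm_nonneg b]
  set W := (r : ℂ) * Complex.log (1 + a) + m * Complex.log (1 + -b) with hW
  have hexp : (1 + a) ^ r * (1 - b) ^ m = Complex.exp W := by
    rw [hW, Complex.exp_add, Complex.exp_nat_mul, Complex.exp_nat_mul, Complex.exp_log ha0,
      Complex.exp_log hb0, ← sub_eq_add_neg]
  have hWx : ‖W + x ^ 2‖ ≤ T := by
    have e : W + x ^ 2 = (r : ℂ) * (Complex.log (1 + a) - (a - a ^ 2 / 2)) +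
        (m + 1) * (Complex.log (1 + -b) - (-b - (-b) ^ 2 / 2)) - Complex.log (1 + -b) := by
      rw [hW]
      linear_combination h1 - h2 / 2
    rw [e]
    refine (norm_sub_le _ _).trans (le_trans ?_ hT)
    refine add_le_add ((norm_add_le _ _).trans (add_le_add ?_ ?_)) hb4
    · rw [norm_mul, Complex.norm_natCast]
      gcongr
    · rw [norm_mul]
      have : ‖(m + 1 : ℂ)‖ = m + 1 := by exact_mod_cast Complex.norm_natCast (m + 1)
      rw [this]
      gcongr
  have e2 : Complex.exp W - Complex.exp (-x ^ 2) =
      Complex.exp (-x ^ 2) * (Complex.exp (W + x ^ 2) - 1) := by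
    rw [mul_sub, ← Complex.exp_add]
    ring_nf
  rw [hexp, e2, norm_mul]
  gcongr
  · rw [Complex.norm_exp]
    apply Real.exp_le_exp.2
    calc (-x ^ 2).re ≤ ‖-x ^ 2‖ := Complex.re_le_norm _
      _ = ‖x‖ ^ 2 := by rw [norm_neg, norm_pow]
  · have := Complex.norm_exp_sub_one_le (hWx.trans hT1)
    linarith

/-! ### The local limit at the saddle point -/

/-- The filter of pairs `(r, n)` with `r, n → ∞` and `δ < r / n < 1 - δ`. -/
def binomIndexFilter (δ : ℝ) : Filter (ℕ × ℕ) :=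
  Filter.atTop ⊓ Filter.principal {p | δ < (p.1 : ℝ) / p.2 ∧ (p.1 : ℝ) / p.2 < 1 - δ}

theorem eventually_binomIndexFilter {δ : ℝ} {P : ℕ × ℕ → Prop} :
    (∀ᶠ p in binomIndexFilter δ, P p) ↔ ∃ N : ℕ, ∀ r n : ℕ, N ≤ r → N ≤ n →
      δ < (r : ℝ) / n → (r : ℝ) / n < 1 - δ → P (r, n) := by
  rw [binomIndexFilter, Filter.eventually_inf_principal, Filter.eventually_atTop_prod_self]
  simp

theorem eventually_ratio_mem (δ : ℝ) (hδ : 0 < δ) : ∀ᶠ p : ℕ × ℕ in binomIndexFilter δ,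
    0 < p.1 ∧ p.1 < p.2 ∧ δ < (p.1 : ℝ) / p.2 ∧ (p.1 : ℝ) / p.2 < 1 - δ := by
  rw [eventually_binomIndexFilter]
  refine ⟨1, fun r n hr hn h1 h2 => ⟨hr, ?_, h1, h2⟩⟩
  have hn' : (0 : ℝ) < n := by exact_mod_cast hn
  have : (r : ℝ) / n < 1 := by linarith
  rw [div_lt_one hn'] at this
  exact_mod_cast this


theorem tendsto_fst_binomIndexFilter (δ : ℝ) :
    Tendsto (fun p : ℕ × ℕ => p.1) (binomIndexFilter δ) atTop := by
  refine Tendsto.mono_left ?_ inf_le_left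
  rw [← prod_atTop_atTop_eq]
  exact tendsto_fst

theorem tendsto_snd_binomIndexFilter (δ : ℝ) :
    Tendsto (fun p : ℕ × ℕ => p.2) (binomIndexFilter δ) atTop := by
  refine Tendsto.mono_left ?_ inf_le_left
  rw [← prod_atTop_atTop_eq]
  exact tendsto_snd

theorem tendsto_sub_binomIndexFilter {δ : ℝ} (hδ : 0 < δ) :
    Tendsto (fun p : ℕ × ℕ => p.2 - p.1) (binomIndexFilter δ) atTop := by
  rw [← tendsto_natCast_atTop_iff (R := ℝ)]
  have h : Tendsto (fun p : ℕ × ℕ => δ * (p.2 : ℝ)) (binomIndexFilter δ) atTop :=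
    (tendsto_natCast_atTop_atTop.comp (tendsto_snd_binomIndexFilter δ)).const_mul_atTop hδ
  refine tendsto_atTop_mono' _ ?_ h
  filter_upwards [eventually_ratio_mem δ hδ] with p ⟨_, h2, _, h4⟩
  rw [Nat.cast_sub h2.le]
  have hn : (0 : ℝ) < p.2 := by exact_mod_cast (Nat.zero_lt_of_lt h2)
  rw [div_lt_iff₀ hn] at h4
  linarith

theorem tendsto_const_div_sqrt (δ c : ℝ) :
    Tendsto (fun p : ℕ × ℕ => c / √(p.2 : ℝ)) (binomIndexFilter δ) (𝓝 0) :=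
  (tendsto_sqrt_atTop.comp
    (tendsto_natCast_atTop_atTop.comp (tendsto_snd_binomIndexFilter δ))).const_div_atTop c

/-- `binomCDF` on the scale of the central limit theorem around `r / n`: the argument `x` stands for
`u = α + x √(2 α (1 - α)) / √n`, with `α = r / n` and `p = (r, n)`. -/
noncomputable def rescaledCDF (p : ℕ × ℕ) (x : ℂ) : ℂ :=
  binomCDF p.1 p.2 (((p.1 / p.2 : ℝ) : ℂ) +
    ((√(2 * (p.1 / p.2) * (1 - p.1 / p.2)) / √p.2 : ℝ) : ℂ) * x)

theorem differentiable_rescaledCDF (p : ℕ × ℕ) : Differentiable ℂ (rescaledCDF p) := by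
  unfold rescaledCDF
  exact (differentiable_binomCDF _ _).comp (by fun_prop)

theorem hasDerivAt_rescaledCDF {r m n : ℕ} (hr : 0 < r) (hn : n = r + m + 1) {α s : ℝ}
    (hα : α = r / n) (hs : s = √(2 * (r / n) * (1 - r / n)) / √n) (x : ℂ) :
    HasDerivAt (rescaledCDF (r, n))
      (-((Stirling.stirlingSeq n / (Stirling.stirlingSeq r * Stirling.stirlingSeq (m + 1)) : ℝ) *
        ((1 + ((s / α : ℝ) : ℂ) * x) ^ r * (1 - ((s / (1 - α) : ℝ) : ℂ) * x) ^ m))) x := by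
  have hr' : (0 : ℝ) < r := by exact_mod_cast hr
  have hn' : (0 : ℝ) < n := by rw [hn]; positivity
  have hα1 : 1 - α = ((m + 1 : ℕ) : ℝ) / n := by
    rw [hα, eq_div_iff hn'.ne', sub_mul, div_mul_cancel₀ _ hn'.ne', hn]
    push_cast; ring
  have hα0 : α ≠ 0 := by rw [hα]; positivity
  have hα10 : 1 - α ≠ 0 := by rw [hα1]; positivity
  have h0 : HasDerivAt (fun x : ℂ => (α : ℂ) + (s : ℂ) * x) (s : ℂ) x := by
    simpa using ((hasDerivAt_id x).const_mul (s : ℂ)).const_add (α : ℂ)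
  have h1 := (hasDerivAt_binomCDF (r := r) (m := m) ((α : ℂ) + (s : ℂ) * x)).comp x h0
  have hfun : rescaledCDF (r, n) = binomCDF r (r + m + 1) ∘ fun x : ℂ => (α : ℂ) + (s : ℂ) * x := by
    funext x
    simp only [rescaledCDF, Function.comp, hα, hs, hn]
  rw [hfun]
  refine h1.congr_deriv ?_
  rw [← sqrt_mul_choose_mul_eq_stirlingSeq hr (by omega : 0 < m + 1) (by omega : n = r + (m + 1))]
  have hαc : (α : ℂ) ≠ 0 := by exact_mod_cast hα0
  have hα1c : (1 - α : ℂ) ≠ 0 := by exact_mod_cast hα10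
  have e1 : (α : ℂ) + s * x = α * (1 + ((s / α : ℝ) : ℂ) * x) := by
    push_cast; field_simp
  have e2 : 1 - ((α : ℂ) + s * x) = (1 - α) * (1 - ((s / (1 - α) : ℝ) : ℂ) * x) := by
    push_cast; field_simp; ring
  rw [e2, e1, mul_pow, mul_pow]
  have e3 : √(2 * (r / n) * (((m + 1 : ℕ) : ℝ) / n)) * √n = s * n := by
    rw [hs, ← hα1, hα]
    have h3 : √(n : ℝ) ≠ 0 := by positivity
    field_simp
    rw [Real.sq_sqrt hn'.le]
    ring
  rw [e3, ← hα, ← hα1, hn]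
  have e4 : (m + 1 : ℂ) = (n : ℂ) * (1 - α) := by
    have : ((m + 1 : ℕ) : ℝ) = n * (1 - α) := by rw [hα1]; field_simp
    exact_mod_cast congrArg (fun t : ℝ => (t : ℂ)) this
  rw [e4, hn]
  push_cast
  ring

theorem tendsto_stirlingSeq_ratio {δ : ℝ} (hδ : 0 < δ) :
    Tendsto (fun p : ℕ × ℕ => Stirling.stirlingSeq p.2 /
      (Stirling.stirlingSeq p.1 * Stirling.stirlingSeq (p.2 - p.1))) (binomIndexFilter δ)
      (𝓝 (1 / √π)) := by
  have h := Stirling.tendsto_stirlingSeq_sqrt_pi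
  have hpi : √π ≠ 0 := by positivity
  have := (h.comp (tendsto_snd_binomIndexFilter δ)).div
    ((h.comp (tendsto_fst_binomIndexFilter δ)).mul (h.comp (tendsto_sub_binomIndexFilter hδ)))
    (mul_ne_zero hpi hpi)
  have e : √π / (√π * √π) = 1 / √π := by field_simp
  rw [e] at this
  exact this

theorem sqrt_two_mul_mul_one_sub_le_one {α : ℝ} : √(2 * α * (1 - α)) ≤ 1 := by
  rw [Real.sqrt_le_iff]
  exact ⟨zero_le_one, by nlinarith [sq_nonneg (α - 1 / 2)]⟩

/-- The local limit theorem in the complex domain, uniformly on discs. -/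
theorem eventually_norm_deriv_sub_le {δ : ℝ} (hδ : 0 < δ) {R η : ℝ} (hR : 0 < R) (hη : 0 < η) :
    ∀ᶠ p in binomIndexFilter δ, ∀ x : ℂ, ‖x‖ ≤ R →
      ‖deriv (rescaledCDF p) x + (1 / √π : ℝ) * Complex.exp (-x ^ 2)‖ ≤ η := by
  set S : ℕ × ℕ → ℝ := fun p => Stirling.stirlingSeq p.2 /
      (Stirling.stirlingSeq p.1 * Stirling.stirlingSeq (p.2 - p.1)) with hS
  have hSlim : Tendsto S (binomIndexFilter δ) (𝓝 (1 / √π)) := tendsto_stirlingSeq_ratio hδ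
  -- `c / √n` bounds the remainder `T` of `norm_one_add_pow_mul_sub_exp_le` for `‖x‖ ≤ R`
  set c : ℝ := 2 * (R / δ) ^ 3 + 2 * (R / δ) with hc
  have hbound : Tendsto (fun p : ℕ × ℕ => |S p| * (Real.exp (R ^ 2) * (2 * (c / √(p.2 : ℝ)))) +
      |S p - 1 / √π| * Real.exp (R ^ 2)) (binomIndexFilter δ) (𝓝 0) := by
    have h1 := hSlim.abs.mul (((tendsto_const_div_sqrt δ c).const_mul 2).const_mul
      (Real.exp (R ^ 2)))
    have h2 := ((hSlim.sub_const (1 / √π)).abs).mul_const (Real.exp (R ^ 2))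
    simpa using h1.add h2
  have hT := (tendsto_const_div_sqrt δ c).eventually (ge_mem_nhds one_pos)
  have hRn := (tendsto_const_div_sqrt δ (R / δ)).eventually
    (ge_mem_nhds (by norm_num : (0 : ℝ) < 1 / 2))
  filter_upwards [eventually_ratio_mem δ hδ, hbound.eventually (ge_mem_nhds hη), hT, hRn]
    with p ⟨hr, hrn, hα, hα'⟩ hb hT hRn x hx
  obtain ⟨r, n⟩ := p
  simp only at hr hrn hα hα' hb hT hRn
  obtain ⟨m, hm⟩ := Nat.exists_eq_add_of_lt hrn
  have hn0 : (0 : ℝ) < n := by exact_mod_cast (hr.trans hrn)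
  set α : ℝ := (r : ℝ) / n with hαdef
  set s : ℝ := √(2 * α * (1 - α)) / √n with hs
  have hsq : 0 < √(n : ℝ) := by positivity
  have hs0 : 0 ≤ s := by positivity
  have hs1 : s ≤ 1 / √n := by
    rw [hs]; gcongr; exact sqrt_two_mul_mul_one_sub_le_one
  rw [(hasDerivAt_rescaledCDF hr hm hαdef hs x).deriv]
  have hm1 : n - r = m + 1 := by omega
  have hSS : Stirling.stirlingSeq n / (Stirling.stirlingSeq r * Stirling.stirlingSeq (m + 1)) =
      S (r, n) := by simp only [hS, hm1]
  rw [hSS]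
  set a : ℂ := ((s / α : ℝ) : ℂ) * x with ha
  set b : ℂ := ((s / (1 - α) : ℝ) : ℂ) * x with hb'
  have hα0 : 0 < α := hδ.trans hα
  have hα1 : δ < 1 - α := by linarith
  have hα10 : 0 < 1 - α := hδ.trans hα1
  have hgen : ∀ t : ℝ, δ < t → ‖((s / t : ℝ) : ℂ) * x‖ ≤ R / δ / √n := by
    intro t ht
    have ht0 := hδ.trans ht
    rw [norm_mul, Complex.norm_real, Real.norm_of_nonneg (by positivity)]
    calc s / t * ‖x‖ ≤ (1 / √n) / δ * R := by gcongr
      _ = _ := by field_simp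
  have hna := hgen α hα
  have hnb := hgen (1 - α) hα1
  have hrr : (r : ℝ) = n * α := by rw [hαdef]; field_simp
  have hmm : (m + 1 : ℝ) = n * (1 - α) := by
    rw [mul_sub, ← hrr, hm]; push_cast; ring
  have hrc : (r : ℂ) = n * α := by exact_mod_cast congrArg (fun t : ℝ => (t : ℂ)) hrr
  have hmc : (m + 1 : ℂ) = n * (1 - α) := by exact_mod_cast congrArg (fun t : ℝ => (t : ℂ)) hmm
  have hαc : (α : ℂ) ≠ 0 := by exact_mod_cast hα0.ne'
  have hα1c : (1 - α : ℂ) ≠ 0 := by exact_mod_cast hα10.ne'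
  have hs2 : n * s ^ 2 = 2 * α * (1 - α) := by
    rw [hs, div_pow, Real.sq_sqrt (by positivity), Real.sq_sqrt hn0.le]
    field_simp
  have hs2c : (n : ℂ) * s ^ 2 = 2 * α * (1 - α) := by
    exact_mod_cast congrArg (fun t : ℝ => (t : ℂ)) hs2
  have hkey := norm_one_add_pow_mul_sub_exp_le (r := r) (m := m) (a := a) (b := b) (x := x)
    (T := c / √n) (hna.trans hRn) (hnb.trans hRn)
    (by rw [hrc, hmc, ha, hb']; push_cast; field_simp)
    (by
      rw [hrc, hmc, ha, hb']; push_cast; field_simp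
      linear_combination x ^ 2 * hs2c)
    (by
      have hx3 : (R / δ / √n) ^ 3 * n = (R / δ) ^ 3 / √n := by
        rw [div_pow, pow_succ (√(n : ℝ)) 2, Real.sq_sqrt hn0.le]
        field_simp
      have h1 : r * ‖a‖ ^ 3 ≤ n * (R / δ / √n) ^ 3 := by
        have : (r : ℝ) ≤ n := by exact_mod_cast hrn.le
        gcongr
      have h2 : (m + 1) * ‖b‖ ^ 3 ≤ n * (R / δ / √n) ^ 3 := by
        have : (m + 1 : ℝ) ≤ n := by rw [hmm]; nlinarith
        gcongr
      have : c / √n = 2 * ((R / δ) ^ 3 / √n) + 2 * (R / δ / √n) := by rw [hc]; field_simp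
      rw [this]
      linarith)
    hT
  refine le_trans ?_ hb
  set A := (1 + a) ^ r * (1 - b) ^ m
  have e : -((S (r, n) : ℂ) * A) + (1 / √π : ℝ) * Complex.exp (-x ^ 2) =
      -((S (r, n) : ℂ) * (A - Complex.exp (-x ^ 2)) +
        ((S (r, n) - 1 / √π : ℝ) : ℂ) * Complex.exp (-x ^ 2)) := by
    push_cast; ring
  have hxR : Real.exp (‖x‖ ^ 2) ≤ Real.exp (R ^ 2) := by gcongr
  have hE : ‖Complex.exp (-x ^ 2)‖ ≤ Real.exp (R ^ 2) := by
    refine le_trans ?_ hxR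
    rw [Complex.norm_exp]
    apply Real.exp_le_exp.2
    calc (-x ^ 2).re ≤ ‖-x ^ 2‖ := Complex.re_le_norm _
      _ = ‖x‖ ^ 2 := by rw [norm_neg, norm_pow]
  have hc0 : 0 < c := by positivity
  rw [e, norm_neg]
  refine (norm_add_le _ _).trans ?_
  rw [norm_mul, norm_mul, Complex.norm_real, Complex.norm_real, Real.norm_eq_abs,
    Real.norm_eq_abs]
  gcongr
  exact hkey.trans (by gcongr)

/-- The central limit theorem in the complex domain: the difference to `erfc / 2` is small at a large
positive `Q`, by Chebyshev's inequality, and its derivative is small on the disc of radius `Q`. -/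
theorem eventually_norm_rescaledCDF_sub_le {δ : ℝ} (hδ : 0 < δ) {R η : ℝ} (hη : 0 < η) :
    ∀ᶠ p in binomIndexFilter δ, ∀ x : ℂ, ‖x‖ ≤ R →
      ‖rescaledCDF p x - complexErfc x / 2‖ ≤ η := by
  have hlim1 : Tendsto (fun t : ℝ => 1 / (8 * δ ^ 2 * t ^ 2)) atTop (𝓝 0) := by
    have : Tendsto (fun t : ℝ => 8 * δ ^ 2 * t ^ 2) atTop atTop :=
      (tendsto_pow_atTop two_ne_zero).const_mul_atTop (by positivity)
    exact this.const_div_atTop 1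
  have hlim2 := (tendsto_complexErfc_atTop).norm
  rw [norm_zero] at hlim2
  obtain ⟨Q, hQ1, hQ2, hQR, hQ0⟩ := ((hlim1.eventually (ge_mem_nhds (by positivity : 0 < η / 4))).and
    ((hlim2.eventually (ge_mem_nhds (by positivity : 0 < η / 4))).and
      ((eventually_ge_atTop R).and (eventually_gt_atTop 0)))).exists
  have hη' : 0 < η / (4 * Q) := by positivity
  filter_upwards [eventually_ratio_mem δ hδ, eventually_norm_deriv_sub_le hδ hQ0 hη',
    (tendsto_const_div_sqrt δ Q).eventually (ge_mem_nhds hδ)]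
    with p ⟨hr, hrn, hα, hα'⟩ hd hQn x hx
  have hD : ∀ x : ℂ, HasDerivAt (fun x => rescaledCDF p x - complexErfc x / 2)
      (deriv (rescaledCDF p) x + (1 / √π : ℝ) * Complex.exp (-x ^ 2)) x := by
    intro x
    refine ((differentiable_rescaledCDF p x).hasDerivAt.sub
      ((hasDerivAt_complexErfc x).div_const 2)).congr_deriv ?_
    push_cast
    ring
  have hmv := (convex_closedBall (0 : ℂ) Q).norm_image_sub_le_of_norm_hasDerivWithin_le
    (fun x _ => (hD x).hasDerivWithinAt)
    (fun x hx => hd x (mem_closedBall_zero_iff.1 hx))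
    (x := (Q : ℂ)) (y := x) (by simp [abs_of_pos hQ0])
    (mem_closedBall_zero_iff.2 (hx.trans hQR))
  have hxQ : ‖x - (Q : ℂ)‖ ≤ 2 * Q := by
    refine (norm_sub_le _ _).trans ?_
    rw [Complex.norm_real, Real.norm_of_nonneg hQ0.le]
    linarith
  have h1 : η / (4 * Q) * ‖x - (Q : ℂ)‖ ≤ η / 2 := by
    calc _ ≤ η / (4 * Q) * (2 * Q) := by gcongr
      _ = _ := by field_simp; norm_num
  have hn0 : 0 < p.2 := hr.trans hrn
  have hn0' : (0 : ℝ) < p.2 := by exact_mod_cast hn0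
  have h2 : ‖rescaledCDF p Q‖ ≤ η / 4 := by
    refine le_trans ?_ hQ1
    set α : ℝ := (p.1 : ℝ) / p.2 with hαdef
    set σ : ℝ := √(2 * α * (1 - α)) with hσ
    have hα10 : δ < 1 - α := by linarith
    have hσ2 : σ ^ 2 = 2 * α * (1 - α) := Real.sq_sqrt (by
      have := hδ.trans hα; have := hδ.trans hα10; positivity)
    have hσδ : 2 * δ ^ 2 ≤ σ ^ 2 := by
      rw [hσ2]; nlinarith
    have hσ0 : 0 < σ := by
      rw [hσ]; apply Real.sqrt_pos.2
      have := hδ.trans hα; have := hδ.trans hα10; positivity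
    have hsq : 0 < √(p.2 : ℝ) := by positivity
    have e : rescaledCDF p Q = binomCDF p.1 p.2 ((α + σ / √p.2 * Q : ℝ) : ℂ) := by
      simp only [rescaledCDF, Complex.ofReal_add, Complex.ofReal_mul, hαdef, hσ]
    have hle : σ / √p.2 * Q ≤ δ := by
      calc σ / √p.2 * Q ≤ 1 / √p.2 * Q := by gcongr; exact sqrt_two_mul_mul_one_sub_le_one
        _ = Q / √p.2 := by ring
        _ ≤ δ := hQn
    rw [e]
    refine (norm_binomCDF_le hrn.le hn0 (by linarith) (by
      rw [← hαdef]; have : 0 < σ / √p.2 * Q := by positivity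
      linarith)).trans ?_
    apply one_div_le_one_div_of_le (by positivity)
    rw [← hαdef, add_sub_cancel_left, mul_pow, div_pow, Real.sq_sqrt hn0'.le]
    have : 4 * ((p.2 : ℝ) * (σ ^ 2 / p.2 * Q ^ 2)) = 4 * σ ^ 2 * Q ^ 2 := by field_simp
    rw [this]
    linarith [mul_le_mul_of_nonneg_right hσδ (sq_nonneg Q)]
  have h3 : ‖complexErfc Q / 2‖ ≤ η / 4 := by
    rw [norm_div, Complex.norm_ofNat]
    linarith [norm_nonneg (complexErfc Q)]
  have e : rescaledCDF p x - complexErfc x / 2 =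
      ((rescaledCDF p x - complexErfc x / 2) - (rescaledCDF p Q - complexErfc Q / 2)) +
        rescaledCDF p Q - complexErfc Q / 2 := by ring
  rw [e]
  refine (norm_sub_le _ _).trans ?_
  have := norm_add_le ((rescaledCDF p x - complexErfc x / 2) -
    (rescaledCDF p Q - complexErfc Q / 2)) (rescaledCDF p Q)
  linarith

/-- Hurwitz's theorem in quantitative form: near a zero `χ` of an entire function `g ≢ 0`, every entire
function close enough to `g` on a fixed disc has a zero. -/
theorem exists_zero_of_norm_sub_le {g : ℂ → ℂ} (hg : Differentiable ℂ g) {χ : ℂ} (hχ : g χ = 0)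
    (hne : ∃ z, g z ≠ 0) {κ : ℝ} (hκ : 0 < κ) : ∃ η > 0, ∀ f : ℂ → ℂ, Differentiable ℂ f →
      (∀ x, ‖x‖ ≤ ‖χ‖ + κ → ‖f x - g x‖ ≤ η) → ∃ x, ‖x - χ‖ ≤ κ ∧ f x = 0 := by
  have hga : AnalyticOnNhd ℂ g univ := hg.differentiableOn.analyticOnNhd isOpen_univ
  have hiso : ∀ᶠ z in 𝓝[≠] χ, g z ≠ 0 := by
    rcases (hga χ (mem_univ χ)).eventually_eq_zero_or_eventually_ne_zero with h | h
    · obtain ⟨z, hz⟩ := hne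
      exact absurd (hga.eqOn_zero_of_preconnected_of_eventuallyEq_zero isPreconnected_univ
        (mem_univ χ) h (mem_univ z)) hz
    · exact h
  rw [eventually_nhdsWithin_iff, Metric.eventually_nhds_iff_ball] at hiso
  obtain ⟨ρ, hρ, hball⟩ := hiso
  set τ := min κ (ρ / 2) with hτ
  have hτ0 : 0 < τ := by positivity
  have hτκ : τ ≤ κ := min_le_left _ _
  have hτρ : τ < ρ := (min_le_right _ _).trans_lt (by linarith)
  obtain ⟨z₁, hz₁, hmin⟩ := (isCompact_sphere χ τ).exists_isMinOn
    ((NormedSpace.sphere_nonempty).2 hτ0.le) (hg.continuous.norm.continuousOn)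
  set M := ‖g z₁‖ with hM
  have hM0 : 0 < M := by
    refine norm_pos_iff.2 (hball z₁ ?_ ?_)
    · rw [Metric.mem_ball, Metric.mem_sphere.1 hz₁]; exact hτρ
    · exact Metric.ne_of_mem_sphere hz₁ hτ0.ne'
  refine ⟨M / 8, by positivity, fun f hf hfg => ?_⟩
  have hdisc : ∀ x, ‖x - χ‖ ≤ τ → ‖f x - g x‖ ≤ M / 8 := fun x hx => hfg x (by
    calc ‖x‖ = ‖χ + (x - χ)‖ := by ring_nf
      _ ≤ ‖χ‖ + ‖x - χ‖ := norm_add_le _ _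
      _ ≤ _ := by linarith)
  have hfχ : ‖f χ‖ ≤ M / 8 := by
    have := hdisc χ (by simpa using hτ0.le)
    rwa [hχ, sub_zero] at this
  have hsph : ∀ z ∈ Metric.sphere χ τ, 3 * M / 4 ≤ ‖f z - f χ‖ := by
    intro z hz
    have h1 := hdisc z (mem_sphere_iff_norm.1 hz).le
    have h2 : M ≤ ‖g z‖ := hmin hz
    have h3 : ‖g z‖ ≤ ‖f z - f χ‖ + ‖f χ‖ + ‖f z - g z‖ := by
      calc ‖g z‖ = ‖(f z - f χ) + f χ - (f z - g z)‖ := by ring_nf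
        _ ≤ ‖(f z - f χ) + f χ‖ + ‖f z - g z‖ := norm_sub_le _ _
        _ ≤ _ := by gcongr; exact norm_add_le _ _
    linarith
  have hfreq : ∃ᶠ z in 𝓝 χ, f z ≠ f χ := by
    intro h
    have h' : f =ᶠ[𝓝 χ] fun _ => f χ := h.mono fun z hz => not_not.1 hz
    have hfa : AnalyticOnNhd ℂ f univ := hf.differentiableOn.analyticOnNhd isOpen_univ
    have := hfa.eq_of_eventuallyEq analyticOnNhd_const h'
    have h3 := hsph z₁ hz₁
    rw [this] at h3
    simp at h3
    linarith
  obtain ⟨x, hx, hfx⟩ := hf.diffContOnCl.ball_subset_image_closedBall hτ0 hsph hfreq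
    (show (0 : ℂ) ∈ Metric.ball (f χ) (3 * M / 4 / 2) by
      rw [mem_ball_iff_norm, zero_sub, norm_neg]; linarith)
  exact ⟨x, (mem_closedBall_iff_norm.1 hx).trans hτκ, hfx⟩

theorem exists_complexErfc_div_two_ne_zero : ∃ z, complexErfc z / 2 ≠ 0 := by
  by_contra! h
  have h0 : complexErfc = fun _ => 0 := funext fun z => by simpa using h z
  have h1 := hasDerivAt_complexErfc 0
  rw [h0] at h1
  have h2 := h1.unique (hasDerivAt_const 0 0)
  have : (2 / √π : ℝ) ≠ 0 := by positivity
  have h3 : ((2 / √π : ℝ) : ℂ) ≠ 0 := by exact_mod_cast this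
  simp at h2
  exact (by positivity : √π ≠ 0) (by exact_mod_cast h2)

theorem eventually_exists_zero_near {δ : ℝ} (hδ : 0 < δ) {χ : ℂ} (hχ : complexErfc χ = 0)
    {ε : ℝ} (hε : 0 < ε) : ∀ᶠ p : ℕ × ℕ in binomIndexFilter δ,
      ∃ z : ℂ, binomSection p.1 p.2 z = 0 ∧
        ‖z - ((p.1 : ℂ) / ((p.2 : ℂ) - (p.1 : ℂ)) +
            (√(2 * ((p.1 : ℝ) / (p.2 : ℝ)) / (1 - (p.1 : ℝ) / (p.2 : ℝ)) ^ 3) : ℝ) *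
              (χ / (√(p.2 : ℝ) : ℝ)))‖ ≤ ε / √(p.2 : ℝ) := by
  -- a radius `κ` in `x` becomes at most `κ / (δ² √n)` in `z`
  set κ : ℝ := ε * δ ^ 2 / 2 with hκ
  have hκ0 : 0 < κ := by positivity
  have hgd : Differentiable ℂ fun z => complexErfc z / 2 := fun z =>
    (hasDerivAt_complexErfc z).differentiableAt.div_const 2
  obtain ⟨η, hη, hH⟩ := exists_zero_of_norm_sub_le hgd (by simp [hχ] : complexErfc χ / 2 = 0)
    exists_complexErfc_div_two_ne_zero hκ0
  set R := ‖χ‖ + κ with hR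
  have hR0 : 0 < R := by positivity
  filter_upwards [eventually_ratio_mem δ hδ, eventually_norm_rescaledCDF_sub_le hδ (R := R) hη,
    (tendsto_const_div_sqrt δ R).eventually (ge_mem_nhds (by positivity : 0 < δ / 2)),
    (tendsto_const_div_sqrt δ (2 * R ^ 2 / δ ^ 3)).eventually
      (ge_mem_nhds (by positivity : 0 < ε / 2))] with ⟨r, n⟩ ⟨hr, hrn, hα, hα'⟩ hfg hRn hRn2
  simp only at hr hrn hα hα' hfg hRn hRn2 ⊢
  obtain ⟨x, hxχ, hx0⟩ := hH _ (differentiable_rescaledCDF (r, n)) hfg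
  have hxR : ‖x‖ ≤ R := by
    calc ‖x‖ = ‖χ + (x - χ)‖ := by ring_nf
      _ ≤ ‖χ‖ + ‖x - χ‖ := norm_add_le _ _
      _ ≤ _ := by linarith
  have hn0 : (0 : ℝ) < n := by exact_mod_cast (hr.trans hrn)
  have hsq : 0 < √(n : ℝ) := by positivity
  simp only [rescaledCDF] at hx0
  set α : ℝ := (r : ℝ) / n with hαdef
  set σ : ℝ := √(2 * α * (1 - α)) with hσ
  have hα1 : δ < 1 - α := by linarith
  have hα0 : 0 < α := hδ.trans hα
  have hα10 : 0 < 1 - α := hδ.trans hα1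
  set w : ℂ := ((σ / √n : ℝ) : ℂ) * x with hw
  have hσ0 : 0 ≤ σ := Real.sqrt_nonneg _
  have hσ1 : σ ≤ 1 := sqrt_two_mul_mul_one_sub_le_one
  have hwn : ‖w‖ ≤ R / √n := by
    rw [hw, norm_mul, Complex.norm_real, Real.norm_of_nonneg (by positivity)]
    calc σ / √n * ‖x‖ ≤ 1 / √n * R := by gcongr
      _ = R / √n := by ring
  have hden : δ / 2 ≤ ‖1 - ((α : ℂ) + w)‖ := by
    have h1 : ‖((1 - α : ℝ) : ℂ)‖ ≤ ‖1 - ((α : ℂ) + w)‖ + ‖w‖ := by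
      calc ‖((1 - α : ℝ) : ℂ)‖ = ‖(1 - ((α : ℂ) + w)) + w‖ := by push_cast; ring_nf
        _ ≤ _ := norm_add_le _ _
    rw [Complex.norm_real, Real.norm_of_nonneg hα10.le] at h1
    linarith
  have hden0 : 1 - ((α : ℂ) + w) ≠ 0 := norm_pos_iff.1 (by linarith)
  have hu1 : (α : ℂ) + w ≠ 1 := fun h => hden0 (by rw [h]; ring)
  rw [binomCDF_eq hrn.le hu1] at hx0
  refine ⟨_, (mul_eq_zero.1 hx0).resolve_left (pow_ne_zero _ hden0), ?_⟩
  have hαc : (1 - α : ℂ) ≠ 0 := by exact_mod_cast hα10.ne'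
  have hz0 : (r : ℂ) / ((n : ℂ) - r) = α / (1 - α) := by
    have h1 : (n : ℂ) ≠ 0 := by exact_mod_cast hn0.ne'
    have h2 : (α : ℂ) = r / n := by rw [hαdef]; push_cast; rfl
    rw [h2] at hαc ⊢
    have h3 : (n : ℂ) - r ≠ 0 := by
      intro h; apply hαc; rw [sub_eq_zero.1 h] at h1 ⊢; field_simp; simp
    field_simp
  have hσ2 : √(2 * α / (1 - α) ^ 3) = σ / (1 - α) ^ 2 := by
    rw [Real.sqrt_eq_iff_mul_self_eq (by positivity) (by positivity), ← sq, div_pow, hσ,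
      Real.sq_sqrt (by positivity)]
    field_simp
  rw [hz0, hσ2]
  have e : ((α : ℂ) + w) / (1 - (α + w)) - (α / (1 - α) +
      ((σ / (1 - α) ^ 2 : ℝ) : ℂ) * (χ / (√(n : ℝ) : ℝ))) =
      w ^ 2 / ((1 - α) ^ 2 * (1 - (α + w))) +
        ((σ / (1 - α) ^ 2 / √n : ℝ) : ℂ) * (x - χ) := by
    have h1 : ((√(n : ℝ) : ℝ) : ℂ) ≠ 0 := by exact_mod_cast hsq.ne'
    have h2 : ((α : ℂ) + w) / (1 - (α + w)) - α / (1 - α) =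
      w ^ 2 / ((1 - α) ^ 2 * (1 - (α + w))) + w / (1 - α) ^ 2 := by
      field_simp
      ring
    rw [← sub_sub, h2, hw]
    push_cast
    field_simp
    ring
  rw [e]
  refine (norm_add_le _ _).trans ?_
  have hn1 : ‖(1 - (α : ℂ))‖ = 1 - α := by
    rw [← Complex.ofReal_one, ← Complex.ofReal_sub, Complex.norm_real,
      Real.norm_of_nonneg hα10.le]
  have hA : ‖w ^ 2 / ((1 - (α : ℂ)) ^ 2 * (1 - (α + w)))‖ ≤ ε / 2 / √n := by
    rw [norm_div, norm_mul, norm_pow, norm_pow, hn1]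
    calc ‖w‖ ^ 2 / ((1 - α) ^ 2 * ‖1 - (↑α + w)‖) ≤ (R / √n) ^ 2 / (δ ^ 2 * (δ / 2)) := by
          gcongr
      _ = 2 * R ^ 2 / δ ^ 3 / √n / √n := by field_simp
      _ ≤ ε / 2 / √n := by gcongr
  have hB : ‖((σ / (1 - α) ^ 2 / √n : ℝ) : ℂ) * (x - χ)‖ ≤ ε / 2 / √n := by
    rw [norm_mul, Complex.norm_real, Real.norm_of_nonneg (by positivity)]
    calc σ / (1 - α) ^ 2 / √n * ‖x - χ‖ ≤ 1 / δ ^ 2 / √n * κ := by gcongr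
      _ = ε / 2 / √n := by rw [hκ]; field_simp
  calc _ ≤ ε / 2 / √n + ε / 2 / √n := add_le_add hA hB
    _ = ε / √n := by ring

/-! ### Two-sided bounds at the zeros -/

/-- The Eneström–Kakeya estimate: if the coefficients decrease, multiplication by `1 - y` leaves the
leading term `e 0` and differences of total weight `e 0`, each with a factor `y`. -/
theorem mul_one_sub_norm_le_norm_sum (e : ℕ → ℝ) (m : ℕ) (he : ∀ j < m, e (j + 1) ≤ e j)
    (hm : 0 ≤ e m) {y : ℂ} (hy : ‖y‖ ≤ 1) :
    e 0 * (1 - ‖y‖) ≤ ‖(1 - y) * ∑ j ∈ Finset.range (m + 1), (e j : ℂ) * y ^ j‖ := by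
  have key : ∀ k ≤ m, ‖(e 0 : ℂ) - (1 - y) * ∑ j ∈ Finset.range (k + 1), (e j : ℂ) * y ^ j -
      e k * y ^ (k + 1)‖ ≤ ‖y‖ * (e 0 - e k) := by
    intro k
    induction k with
    | zero => intro _; simp; ring_nf
    | succ k ih =>
      intro hk
      have h1 := ih (by omega)
      rw [Finset.sum_range_succ]
      have h2 : ‖((e k - e (k + 1) : ℝ) : ℂ) * y ^ (k + 1)‖ ≤ ‖y‖ * (e k - e (k + 1)) := by
        have h3 := he k (by omega)
        rw [norm_mul, Complex.norm_real, Real.norm_of_nonneg (by linarith), norm_pow, mul_comm]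
        gcongr
        exact pow_le_of_le_one (norm_nonneg y) hy (by omega)
      calc _ = ‖((e 0 : ℂ) - (1 - y) * ∑ j ∈ Finset.range (k + 1), (e j : ℂ) * y ^ j -
              e k * y ^ (k + 1)) + ((e k - e (k + 1) : ℝ) : ℂ) * y ^ (k + 1)‖ := by
            congr 1; push_cast; ring
        _ ≤ _ := norm_add_le _ _
        _ ≤ ‖y‖ * (e 0 - e k) + ‖y‖ * (e k - e (k + 1)) := add_le_add h1 h2
        _ = _ := by ring
  have h1 := key m le_rfl
  set S := (1 - y) * ∑ j ∈ Finset.range (m + 1), (e j : ℂ) * y ^ j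
  have h2 : ‖(e m : ℂ) * y ^ (m + 1)‖ ≤ e m * ‖y‖ := by
    rw [norm_mul, Complex.norm_real, Real.norm_of_nonneg hm, norm_pow]
    gcongr
    exact pow_le_of_le_one (norm_nonneg y) hy (by omega)
  have h3 : e 0 ≤ ‖S‖ + ‖(e 0 : ℂ) - S - e m * y ^ (m + 1)‖ + ‖(e m : ℂ) * y ^ (m + 1)‖ := by
    calc e 0 ≤ ‖(e 0 : ℂ)‖ := by rw [Complex.norm_real]; exact le_abs_self _
      _ = ‖S + (e 0 - S - e m * y ^ (m + 1)) + e m * y ^ (m + 1)‖ := by congr 1; ring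
      _ ≤ _ := (norm_add_le _ _).trans (by gcongr; exact norm_add_le _ _)
  linarith

theorem cast_choose_succ_mul {n k : ℕ} (hk : k ≤ n) :
    (n.choose (k + 1) : ℝ) * (k + 1) = n.choose k * (n - k) := by
  have := Nat.choose_succ_right_eq n k
  rw [← Nat.cast_sub hk]
  exact_mod_cast this

/-- The ratio of consecutive coefficients is at most `r / (n - r + 1)`, the value at the top degree, so
the reversed polynomial has decreasing coefficients in the variable `r / ((n - r + 1) z)`. -/
theorem norm_le_of_binomSection_eq_zero {r n : ℕ} (hr : 0 < r) (hrn : r ≤ n) {z : ℂ}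
    (hz : binomSection r n z = 0) : ‖z‖ ≤ r / (n - r + 1) := by
  have hr' : (0 : ℝ) < r := by exact_mod_cast hr
  have hrn' : (r : ℝ) ≤ n := by exact_mod_cast hrn
  have hd : (0 : ℝ) < n - r + 1 := by linarith
  set ρ : ℝ := r / (n - r + 1) with hρ
  have hρ0 : 0 < ρ := by positivity
  by_contra! hlt
  have hz0 : z ≠ 0 := norm_pos_iff.1 (hρ0.trans hlt)
  have hy : ‖(ρ : ℂ) / z‖ < 1 := by
    rw [norm_div, Complex.norm_real, Real.norm_of_nonneg hρ0.le, div_lt_one (hρ0.trans hlt)]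
    exact hlt
  have h := mul_one_sub_norm_le_norm_sum (fun j => n.choose (r - j) / ρ ^ j) r (fun j hj => by
    obtain ⟨k, hk⟩ : ∃ k, r = k + 1 + j := ⟨r - j - 1, by omega⟩
    have e1 : r - (j + 1) = k := by omega
    have e2 : r - j = k + 1 := by omega
    rw [e1, e2, pow_succ, ← div_div, div_right_comm]
    gcongr
    rw [div_le_iff₀ hρ0, hρ, mul_div_assoc', le_div_iff₀ hd]
    have hkn : k ≤ n := by omega
    have h1 := cast_choose_succ_mul hkn
    have hkn' : (k : ℝ) ≤ n := by exact_mod_cast hkn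
    have hk1 : (k + 1 : ℝ) ≤ r := by exact_mod_cast (by omega : k + 1 ≤ r)
    have hk2 : (0 : ℝ) < n - k := by linarith
    have h2 : (k + 1 : ℝ) * (n - r + 1) ≤ r * (n - k) := by
      nlinarith
    have h3 : (0 : ℝ) ≤ n.choose (k + 1) := by positivity
    have h4 := mul_le_mul_of_nonneg_left h2 h3
    refine le_of_mul_le_mul_right ?_ hk2
    calc (n.choose k : ℝ) * (n - r + 1) * (n - k) =
        (n.choose (k + 1) : ℝ) * ((k + 1) * (n - r + 1)) := by
          linear_combination -((n : ℝ) - r + 1) * h1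
      _ ≤ _ := h4
      _ = _ := by ring) (by positivity) hy.le
  have hsum : ∑ j ∈ Finset.range (r + 1), ((n.choose (r - j) / ρ ^ j : ℝ) : ℂ) * ((ρ : ℂ) / z) ^ j =
      binomSection r n z / z ^ r := by
    rw [binomSection, ← Finset.sum_range_reflect, Finset.sum_div]
    refine Finset.sum_congr rfl fun j hj => ?_
    have hj' : j ≤ r := by have := Finset.mem_range.1 hj; omega
    have hρc : (ρ : ℂ) ≠ 0 := by exact_mod_cast hρ0.ne'
    have e : r + 1 - 1 - j = r - j := by omega
    rw [e]
    have e2 : z ^ r = z ^ (r - j) * z ^ j := by rw [← pow_add]; congr 1; omega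
    rw [e2]
    push_cast
    rw [div_pow]
    field_simp
    rw [Nat.sub_sub_self hj']
  simp only [hsum, hz] at h
  simp at h
  have h1 : 0 < (n.choose r : ℝ) := by exact_mod_cast Nat.choose_pos hrn
  have h2 : 0 < 1 - ‖(ρ : ℂ) / z‖ := by linarith
  rw [norm_div, Complex.norm_real, Real.norm_of_nonneg hρ0.le] at h2
  simp only [abs_of_pos hρ0] at h
  nlinarith

theorem one_div_le_norm_of_binomSection_eq_zero {r n : ℕ} (hrn : r ≤ n) (hn : 0 < n) {z : ℂ}
    (hz : binomSection r n z = 0) : 1 / (n : ℝ) ≤ ‖z‖ := by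
  have hn' : (0 : ℝ) < n := by exact_mod_cast hn
  by_contra! hlt
  have hy : ‖(n : ℂ) * z‖ < 1 := by
    rw [norm_mul, Complex.norm_natCast, mul_comm, ← lt_div_iff₀ hn']
    exact hlt
  have h := mul_one_sub_norm_le_norm_sum (fun j => n.choose j / (n : ℝ) ^ j) r (fun j hj => by
    rw [pow_succ, mul_comm, ← div_div]
    gcongr
    rw [div_le_iff₀ hn']
    have h1 := cast_choose_succ_mul (by omega : j ≤ n)
    have h2 : (0 : ℝ) ≤ n.choose (j + 1) := by positivity
    have h3 : (0 : ℝ) ≤ n.choose j := by positivity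
    have h4 : (0 : ℝ) ≤ j := by positivity
    nlinarith) (by positivity) hy.le
  have hsum : ∑ j ∈ Finset.range (r + 1), ((n.choose j / (n : ℝ) ^ j : ℝ) : ℂ) *
      ((n : ℂ) * z) ^ j = binomSection r n z := by
    rw [binomSection]
    refine Finset.sum_congr rfl fun j hj => ?_
    have : (n : ℂ) ≠ 0 := by exact_mod_cast hn.ne'
    push_cast
    rw [mul_pow]
    field_simp
  simp only [hsum, hz] at h
  rw [mul_zero, norm_zero] at h
  simp only [Nat.choose_zero_right, Nat.cast_one, pow_zero, div_one, one_mul] at h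
  linarith

/-- At a zero of the section only the upper part of the binomial expansion of `(1 + z)^n` remains. -/
theorem one_add_pow_eq_of_binomSection_eq_zero {r m n : ℕ} (hn : n = r + m + 1) {z : ℂ}
    (hz : binomSection r n z = 0) : (1 + z) ^ n =
      z ^ (r + 1) * ∑ j ∈ Finset.range (m + 1), (n.choose (r + 1 + j) : ℂ) * z ^ j := by
  rw [add_comm, add_pow, show n + 1 = (r + 1) + (m + 1) by omega, Finset.sum_range_add,
    Finset.mul_sum]
  have h0 : ∑ x ∈ Finset.range (r + 1), z ^ x * 1 ^ (n - x) * (n.choose x : ℂ) = 0 := by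
    rw [← hz, binomSection]
    refine Finset.sum_congr rfl fun j _ => ?_
    rw [one_pow]; ring
  rw [h0, zero_add]
  refine Finset.sum_congr rfl fun j _ => ?_
  rw [one_pow, pow_add]; ring

theorem choose_mul_pow_mul_pow_le_one {r m : ℕ} {α : ℝ} (h0 : 0 ≤ α) (h1 : α ≤ 1) :
    ((r + m).choose r : ℝ) * α ^ r * (1 - α) ^ m ≤ 1 := by
  have h := add_pow α (1 - α) (r + m)
  have h2 : ∀ k ∈ Finset.range (r + m + 1), 0 ≤ α ^ k * (1 - α) ^ (r + m - k) *
      ((r + m).choose k : ℝ) := fun k _ => by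
    have : 0 ≤ 1 - α := by linarith
    positivity
  have h3 := Finset.single_le_sum h2 (Finset.mem_range.2 (by omega : r < r + m + 1))
  rw [← h, Nat.add_sub_cancel_left] at h3
  simp only [add_sub_cancel, one_pow] at h3
  linarith

/-- The modal binomial probability is at least `1 / (4 n)`; the bound used is
`√π ≤ k! / (√(2 k) (k / e)^k) ≤ e / √2`. -/
theorem one_div_le_choose_mul_pow_mul_pow {r m n : ℕ} (hr : 0 < r) (hm : 0 < m) (hn : n = r + m) :
    1 / (4 * n) ≤ (n.choose r : ℝ) * (r / n : ℝ) ^ r * (m / n : ℝ) ^ m := by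
  have hn1 : (1 : ℝ) ≤ n := by exact_mod_cast (by omega : 1 ≤ n)
  have hid := sqrt_mul_choose_mul_eq_stirlingSeq hr hm hn
  have hle : ∀ k : ℕ, 0 < k → Stirling.stirlingSeq k ≤ 2 := by
    intro k hk
    obtain ⟨j, rfl⟩ := Nat.exists_eq_succ_of_ne_zero hk.ne'
    have h1 := Stirling.stirlingSeq'_antitone (Nat.zero_le j)
    simp only [Function.comp] at h1
    refine h1.trans ?_
    rw [show Nat.succ 0 = 1 from rfl, Stirling.stirlingSeq_one, div_le_iff₀ (by positivity)]
    have h2 := Real.exp_one_lt_d9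
    have h3 : (1.4 : ℝ) ≤ √2 := Real.le_sqrt_of_sq_le (by norm_num)
    linarith
  have h1 : (1 : ℝ) ≤ Stirling.stirlingSeq n := by
    refine le_trans ?_ (Stirling.sqrt_pi_le_stirlingSeq (by omega : n ≠ 0))
    rw [Real.one_le_sqrt]
    linarith [Real.pi_gt_three]
  have h2 : 1 / 4 ≤ Stirling.stirlingSeq n / (Stirling.stirlingSeq r * Stirling.stirlingSeq m) := by
    have a1 := hle r hr
    have a2 := hle m hm
    have a3 := stirlingSeq_pos hr
    have a4 := stirlingSeq_pos hm
    rw [div_le_div_iff₀ (by norm_num) (by positivity)]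
    nlinarith
  rw [← hid] at h2
  set P := (n.choose r : ℝ) * (r / n : ℝ) ^ r * (m / n : ℝ) ^ m with hP
  have hP0 : 0 ≤ P := by positivity
  have hs : √(2 * (r / n) * (m / n : ℝ)) ≤ 1 := by
    have : (m / n : ℝ) = 1 - r / n := by
      rw [hn]; push_cast
      have : (0 : ℝ) < r + m := by positivity
      field_simp
      ring
    rw [this]
    exact sqrt_two_mul_mul_one_sub_le_one
  have hs2 : √(n : ℝ) ≤ n := Real.sqrt_le_iff.2 ⟨by linarith, by nlinarith⟩
  have h3 : √(2 * (r / n) * (m / n : ℝ)) * √n * P ≤ 1 * n * P := by gcongr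
  rw [div_le_iff₀ (by positivity)]
  nlinarith

/-- At a zero of the section `‖z‖^r / ‖1 + z‖^n` agrees with its value
`(r / n)^r (1 - r / n)^(n - r)` at the saddle point up to powers of `n`. -/
theorem norm_pow_div_bounds_of_binomSection_eq_zero {r m n : ℕ} (hr : 0 < r) (hn : n = r + m + 1)
    {z : ℂ} (hz : binomSection r n z = 0) :
    1 + z ≠ 0 ∧ (r / n : ℝ) ^ r * ((m + 1 : ℕ) / n : ℝ) ^ (m + 1) / n ≤ ‖z‖ ^ r / ‖1 + z‖ ^ n ∧
      ‖z‖ ^ r / ‖1 + z‖ ^ n ≤ (r / n : ℝ) ^ r * ((m + 1 : ℕ) / n : ℝ) ^ (m + 1) * n ^ 7 := by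
  have hr' : (0 : ℝ) < r := by exact_mod_cast hr
  have hr1 : (1 : ℝ) ≤ r := by exact_mod_cast hr
  have hm0 : (0 : ℝ) ≤ m := by positivity
  have hnr : (n : ℝ) = r + m + 1 := by rw [hn]; push_cast; ring
  have hn2 : (2 : ℝ) ≤ n := by linarith
  have hn0 : (0 : ℝ) < n := by linarith
  have hup : ‖z‖ ≤ r / (m + 2) := by
    have := norm_le_of_binomSection_eq_zero hr (by omega) hz
    convert this using 2
    linarith
  have hlow := one_div_le_norm_of_binomSection_eq_zero (by omega) (by omega) hz
  have hz0 : 0 < ‖z‖ := lt_of_lt_of_le (by positivity) hlow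
  have hpow := one_add_pow_eq_of_binomSection_eq_zero hn hz
  set Q : ℂ := ∑ j ∈ Finset.range (m + 1), (n.choose (r + 1 + j) : ℂ) * z ^ j with hQ
  -- in the variable `y = z / ρ` the coefficients of `Q` decrease, and `1 - ‖y‖ ≥ 1 / (m + 2)`
  set ρ : ℝ := r / (m + 1) with hρ
  have hρ0 : 0 < ρ := by positivity
  set e : ℕ → ℝ := fun j => n.choose (r + 1 + j) * ρ ^ j with he
  set y : ℂ := z / ρ with hy
  have hρc : (ρ : ℂ) ≠ 0 := by exact_mod_cast hρ0.ne'
  have hQe : Q = ∑ j ∈ Finset.range (m + 1), (e j : ℂ) * y ^ j := by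
    refine Finset.sum_congr rfl fun j _ => ?_
    simp only [he, hy]
    push_cast
    rw [div_pow]
    field_simp
  have hy1 : ‖y‖ ≤ (m + 1) / (m + 2) := by
    rw [hy, norm_div, Complex.norm_real, Real.norm_of_nonneg hρ0.le, div_le_iff₀ hρ0]
    refine hup.trans (le_of_eq ?_)
    rw [hρ]
    field_simp
  have hy2 : ‖y‖ ≤ 1 := hy1.trans (by rw [div_le_one (by positivity)]; linarith)
  have hanti : ∀ j < m, e (j + 1) ≤ e j := by
    intro j hj
    have h1 := cast_choose_succ_mul (by omega : r + 1 + j ≤ n)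
    have hj0 : (0 : ℝ) ≤ j := by positivity
    have h2 : (n.choose (r + 1 + j + 1) : ℝ) * ρ ≤ n.choose (r + 1 + j) := by
      rw [hρ, mul_div_assoc', div_le_iff₀ (by positivity)]
      have h3 : (0 : ℝ) < r + 1 + j + 1 := by positivity
      refine le_of_mul_le_mul_right ?_ h3
      push_cast at h1
      have h4 : (r : ℝ) * (n - (r + 1 + j)) ≤ (m + 1) * (r + 1 + j + 1) := by
        rw [hnr]
        nlinarith [mul_nonneg hr'.le hj0, mul_nonneg hm0 hj0]
      have h5 : (0 : ℝ) ≤ n.choose (r + 1 + j) := by positivity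
      calc (n.choose (r + 1 + j + 1) : ℝ) * r * (r + 1 + j + 1) =
          n.choose (r + 1 + j) * (r * (n - (r + 1 + j))) := by linear_combination r * h1
        _ ≤ n.choose (r + 1 + j) * ((m + 1) * (r + 1 + j + 1)) := by gcongr
        _ = _ := by ring
    simp only [he]
    rw [← add_assoc, pow_succ]
    calc _ = (n.choose (r + 1 + j + 1) : ℝ) * ρ * ρ ^ j := by ring
      _ ≤ _ := by gcongr
  have hele : ∀ j ≤ m, e j ≤ e 0 := by
    intro j
    induction j with
    | zero => intro _; exact le_rfl
    | succ j ih => intro hj; exact (hanti j (by omega)).trans (ih (by omega))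
  have he0 : e 0 = n.choose (r + 1) := by simp [he]
  have hch := cast_choose_succ_mul (by omega : r ≤ n)
  rw [show (n : ℝ) - r = m + 1 by linarith] at hch
  have hC0 : (0 : ℝ) < n.choose r := by exact_mod_cast Nat.choose_pos (by omega)
  set C : ℝ := (n.choose r : ℝ) with hC
  have hQup : ‖Q‖ ≤ (m + 1) * e 0 := by
    rw [hQe]
    refine (norm_sum_le _ _).trans ?_
    have : ∀ j ∈ Finset.range (m + 1), ‖(e j : ℂ) * y ^ j‖ ≤ e 0 := by
      intro j hj
      have hej : 0 ≤ e j := by simp only [he]; positivity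
      rw [norm_mul, Complex.norm_real, Real.norm_of_nonneg hej, norm_pow]
      have h1 := pow_le_one₀ (n := j) (norm_nonneg y) hy2
      have h2 := hele j (by have := Finset.mem_range.1 hj; omega)
      nlinarith
    refine (Finset.sum_le_sum this).trans (le_of_eq ?_)
    simp
  have hQlow : e 0 ≤ 2 * (m + 2) * ‖Q‖ := by
    have h := mul_one_sub_norm_le_norm_sum e m hanti (by simp only [he]; positivity) hy2
    rw [← hQe, norm_mul] at h
    have h1 : ‖1 - y‖ ≤ 2 := by
      refine (norm_sub_le _ _).trans ?_
      rw [norm_one]; linarith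
    have h2 : 1 / (m + 2) ≤ 1 - ‖y‖ := by
      have : (1 : ℝ) / (m + 2) = 1 - (m + 1) / (m + 2) := by field_simp; ring
      linarith
    have he00 : 0 ≤ e 0 := by rw [he0]; positivity
    have h3 : e 0 * (1 / (m + 2)) ≤ 2 * ‖Q‖ :=
      calc _ ≤ e 0 * (1 - ‖y‖) := by gcongr
        _ ≤ _ := h
        _ ≤ _ := by gcongr
    rw [mul_one_div, div_le_iff₀ (by positivity)] at h3
    linarith
  have he0pos : 0 < e 0 := by
    rw [he0]; exact_mod_cast Nat.choose_pos (by omega)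
  have hQ0 : 0 < ‖Q‖ := by
    by_contra! h
    have := le_antisymm h (norm_nonneg _)
    rw [this] at hQlow
    linarith
  have h1z : 1 + z ≠ 0 := by
    intro h
    rw [h, zero_pow (by omega)] at hpow
    rcases mul_eq_zero.1 hpow.symm with h | h
    · exact (norm_pos_iff.1 hz0) (pow_eq_zero_iff (by omega) |>.1 h)
    · exact (norm_pos_iff.1 hQ0) h
  have h1z0 : 0 < ‖1 + z‖ := norm_pos_iff.2 h1z
  set E : ℝ := ‖z‖ ^ r / ‖1 + z‖ ^ n with hE
  have hE0 : 0 < E := by positivity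
  have hEQ : E * (‖z‖ * ‖Q‖) = 1 := by
    have h := congrArg norm hpow
    rw [norm_pow, norm_mul, norm_pow] at h
    rw [hE, h]
    field_simp
    ring
  set κ : ℝ := (r / n : ℝ) ^ r * ((m + 1 : ℕ) / n : ℝ) ^ (m + 1) with hκ
  have hκ0 : 0 < κ := by positivity
  have hCκ1 : C * κ ≤ 1 := by
    have := choose_mul_pow_mul_pow_le_one (r := r) (m := m + 1) (α := r / n) (by positivity)
      (by rw [div_le_one hn0]; linarith)
    have e1 : (1 - r / n : ℝ) = ((m + 1 : ℕ) : ℝ) / n := by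
      push_cast; field_simp; linarith
    rw [e1, ← add_assoc, ← hn] at this
    rw [hκ]; linarith
  have hCκ2 : 1 / (4 * n) ≤ C * κ := by
    have := one_div_le_choose_mul_pow_mul_pow hr (Nat.succ_pos m) (by omega : n = r + (m + 1))
    rw [hκ, ← mul_assoc]
    exact this
  refine ⟨h1z, ?_, ?_⟩
  · have h1 : ‖z‖ * e 0 ≤ C := by
      rw [he0]
      calc ‖z‖ * (n.choose (r + 1) : ℝ) ≤ r / (m + 2) * n.choose (r + 1) := by gcongr
        _ ≤ (r + 1) / (m + 1) * n.choose (r + 1) := by gcongr <;> linarith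
        _ = C := by rw [div_mul_eq_mul_div, div_eq_iff (by positivity)]; linarith
    have h2 : ‖z‖ * ‖Q‖ ≤ n * C :=
      calc ‖z‖ * ‖Q‖ ≤ ‖z‖ * ((m + 1) * e 0) := by gcongr
        _ = (m + 1) * (‖z‖ * e 0) := by ring
        _ ≤ n * C := by gcongr; linarith
    rw [div_le_iff₀ hn0]
    calc κ = E * (‖z‖ * ‖Q‖) * κ := by rw [hEQ, one_mul]
      _ ≤ E * (n * C) * κ := by gcongr
      _ = E * n * (C * κ) := by ring
      _ ≤ E * n * 1 := by gcongr
      _ = E * n := mul_one _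
  · have h1 : C ≤ n * e 0 := by
      have : C * 1 ≤ (n.choose (r + 1) : ℝ) * (r + 1) := by
        rw [hch]; gcongr; linarith
      rw [he0]
      have h3 : (r + 1 : ℝ) ≤ n := by linarith
      have h4 : (0 : ℝ) ≤ n.choose (r + 1) := by positivity
      nlinarith
    have h2 : E * C ≤ 2 * n ^ 3 := by
      calc E * C ≤ E * (n * e 0) := by gcongr
        _ ≤ E * (n * (2 * (m + 2) * ‖Q‖)) := by gcongr
        _ ≤ E * (n * (2 * n * ‖Q‖)) := by gcongr; linarith
        _ = 2 * n ^ 3 * (E * (1 / n * ‖Q‖)) := by field_simp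
        _ ≤ 2 * n ^ 3 * (E * (‖z‖ * ‖Q‖)) := by gcongr
        _ = 2 * n ^ 3 := by rw [hEQ, mul_one]
    have h3 : 1 ≤ 4 * n * (C * κ) := by
      rw [div_le_iff₀ (by positivity)] at hCκ2; linarith
    calc E ≤ E * (4 * n * (C * κ)) := le_mul_of_one_le_right hE0.le h3
      _ = 4 * n * κ * (E * C) := by ring
      _ ≤ 4 * n * κ * (2 * n ^ 3) := by gcongr
      _ = κ * (2 ^ 3 * n ^ 4) := by ring
      _ ≤ κ * (n ^ 3 * n ^ 4) := by gcongr
      _ = κ * n ^ 7 := by ring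

/-! ### Stability of the level curve -/

/-- The logarithm of `‖u‖^α ‖1 - u‖^(1 - α)` divided by its value at `u = α`. In terms of
`z = u / (1 - u)` it is the logarithm of `‖z‖^α / (K_α ‖1 + z‖)`. It has its intended meaning only for
`u ≠ 0, 1`, as `Real.log 0 = 0`. -/
noncomputable def levelFn (α : ℝ) (u : ℂ) : ℝ :=
  α * Real.log ‖u‖ + (1 - α) * Real.log ‖1 - u‖ - (α * Real.log α + (1 - α) * Real.log (1 - α))

/-- Stewart's theorem for the point `u` and the cevian ending at `α` on the segment from `0` to `1`. -/
theorem norm_sub_sq_eq (α : ℝ) (u : ℂ) :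
    ‖u - α‖ ^ 2 = α * (‖1 - u‖ ^ 2 - (1 - α) ^ 2) + (1 - α) * (‖u‖ ^ 2 - α ^ 2) := by
  simp only [Complex.sq_norm, Complex.normSq_apply]
  simp
  ring

theorem exp_le_one_add_two_mul {x : ℝ} (h0 : 0 ≤ x) (h1 : x ≤ 1) : Real.exp x ≤ 1 + 2 * x := by
  have := Real.abs_exp_sub_one_le (x := x) (by rwa [abs_of_nonneg h0])
  rw [abs_of_nonneg h0] at this
  linarith [le_abs_self (Real.exp x - 1)]

theorem norm_sub_sq_le_of_lt_norm {α : ℝ} (h0 : 0 < α) (h1 : α < 1) {u : ℂ} (hu : α < ‖u‖)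
    (hr : ‖u‖ * (1 - α) ≤ α * ‖1 - u‖) (hsmall : 2 * levelFn α u ≤ 1 - α) :
    ‖u - α‖ ^ 2 ≤ 8 * |levelFn α u| := by
  have h1' : 0 < 1 - α := by linarith
  have hu0 : 0 < ‖u‖ := h0.trans hu
  have hw0 : 0 < ‖1 - u‖ := by
    by_contra! h
    have : 0 < ‖u‖ * (1 - α) := by positivity
    nlinarith
  set h := levelFn α u with hh
  have hlog1 : 0 < Real.log ‖u‖ - Real.log α := sub_pos.2 (Real.log_lt_log h0 hu)
  have hlog2 : Real.log ‖u‖ - Real.log α ≤ Real.log ‖1 - u‖ - Real.log (1 - α) := by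
    have := Real.log_le_log (by positivity) hr
    rw [Real.log_mul hu0.ne' h1'.ne', Real.log_mul h0.ne' hw0.ne'] at this
    linarith
  have hh2 : h = α * (Real.log ‖u‖ - Real.log α) +
      (1 - α) * (Real.log ‖1 - u‖ - Real.log (1 - α)) := by rw [hh, levelFn]; ring
  set A := Real.log ‖u‖ - Real.log α
  set B := Real.log ‖1 - u‖ - Real.log (1 - α)
  have hA : A ≤ h := by nlinarith
  have hB : (1 - α) * B ≤ h := by nlinarith
  have hh0 : 0 < h := by linarith
  have hu2 : ‖u‖ ^ 2 = α ^ 2 * Real.exp (2 * A) := by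
    rw [two_mul, Real.exp_add, Real.exp_sub, Real.exp_log hu0, Real.exp_log h0]
    field_simp
  have hw2 : ‖1 - u‖ ^ 2 = (1 - α) ^ 2 * Real.exp (2 * B) := by
    rw [two_mul, Real.exp_add, Real.exp_sub, Real.exp_log hw0, Real.exp_log h1']
    field_simp
  have hB1 : 2 * B ≤ 1 := by
    by_contra! hlt
    nlinarith
  have eA := exp_le_one_add_two_mul (by linarith : 0 ≤ 2 * A) (by linarith)
  have eB := exp_le_one_add_two_mul (by linarith : 0 ≤ 2 * B) hB1
  rw [norm_sub_sq_eq, hu2, hw2, abs_of_pos hh0]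
  have i1 : (1 - α) ^ 2 * Real.exp (2 * B) - (1 - α) ^ 2 ≤ 4 * h := by
    have : (1 - α) ^ 2 * Real.exp (2 * B) ≤ (1 - α) ^ 2 * (1 + 2 * (2 * B)) := by gcongr
    nlinarith
  have i2 : α ^ 2 * Real.exp (2 * A) - α ^ 2 ≤ 4 * h := by
    have : α ^ 2 * Real.exp (2 * A) ≤ α ^ 2 * (1 + 2 * (2 * A)) := by gcongr
    have h3 : α ^ 2 ≤ 1 := by nlinarith
    nlinarith
  nlinarith

theorem levelFn_self (α : ℝ) (h0 : 0 < α) (h1 : α < 1) : levelFn α (α : ℂ) = 0 := by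
  have e : ‖(1 : ℂ) - α‖ = 1 - α := by
    rw [← Complex.ofReal_one, ← Complex.ofReal_sub, Complex.norm_real,
      Real.norm_of_nonneg (by linarith)]
  rw [levelFn, e, Complex.norm_real, Real.norm_of_nonneg h0.le]
  ring

/-- In the left half-plane `levelFn` grows along rays from `0` at least like `α log t`, because `‖1 - t u‖`
increases with `t`; so the ray through `u` meets the curve close to `u`. -/
theorem exists_levelFn_eq_zero_of_re_nonpos {α : ℝ} (h0 : 0 < α) (h1 : α < 1) {u : ℂ}
    (hu0 : u ≠ 0) (hu : ‖u‖ ≤ 1) (hre : u.re ≤ 0) (hsmall : |levelFn α u| ≤ α) :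
    ∃ v : ℂ, ‖v‖ ≤ α ∧ v ≠ 0 ∧ levelFn α v = 0 ∧ ‖u - v‖ ≤ 2 / α * |levelFn α u| := by
  have hw : ∀ s : ℝ, 0 ≤ s → 1 ≤ ‖1 - (s : ℂ) * u‖ := by
    intro s hs
    calc (1 : ℝ) ≤ (1 - (s : ℂ) * u).re := by simp; nlinarith
      _ ≤ _ := Complex.re_le_norm _
  have hmono : ∀ s t : ℝ, 0 ≤ s → s ≤ t → ‖1 - (s : ℂ) * u‖ ≤ ‖1 - (t : ℂ) * u‖ := by
    intro s t hs hst
    rw [← sq_le_sq₀ (norm_nonneg _) (norm_nonneg _), Complex.sq_norm, Complex.sq_norm,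
      Complex.normSq_apply, Complex.normSq_apply]
    simp
    have h2 : s ^ 2 ≤ t ^ 2 := by gcongr
    nlinarith [mul_nonneg (sub_nonneg.2 hst) (neg_nonneg.2 hre),
      mul_nonneg (sub_nonneg.2 h2) (add_nonneg (sq_nonneg u.re) (sq_nonneg u.im))]
  set f : ℝ → ℝ := fun t => levelFn α ((Real.exp t : ℝ) * u) with hf
  have hf0 : f 0 = levelFn α u := by simp [hf]
  have hflog : ∀ t, f t = α * t + α * Real.log ‖u‖ +
      (1 - α) * Real.log ‖1 - ((Real.exp t : ℝ) : ℂ) * u‖ -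
      (α * Real.log α + (1 - α) * Real.log (1 - α)) := by
    intro t
    simp only [hf, levelFn]
    rw [norm_mul, Complex.norm_real, Real.norm_of_nonneg (Real.exp_pos t).le,
      Real.log_mul (Real.exp_pos t).ne' (norm_pos_iff.2 hu0).ne', Real.log_exp]
    ring
  have hfmono : ∀ s t, s ≤ t → f s + α * (t - s) ≤ f t := by
    intro s t hst
    rw [hflog, hflog]
    have := Real.log_le_log (by linarith [hw _ (Real.exp_pos s).le])
      (hmono _ _ (Real.exp_pos s).le (Real.exp_le_exp.2 hst))
    nlinarith
  have hcont : Continuous f := by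
    rw [funext hflog]
    refine Continuous.sub (Continuous.add (by fun_prop) (continuous_const.mul ?_)) continuous_const
    refine Continuous.log (by fun_prop) fun t => ?_
    linarith [hw _ (Real.exp_pos t).le]
  set τ := |levelFn α u| / α with hτ
  have hτ0 : 0 ≤ τ := by positivity
  have hατ : α * τ = |levelFn α u| := by rw [hτ]; field_simp
  have hneg : f (-τ) ≤ 0 := by
    have := hfmono (-τ) 0 (by linarith)
    rw [hf0] at this
    linarith [le_abs_self (levelFn α u)]
  have hpos : 0 ≤ f τ := by
    have := hfmono 0 τ hτ0
    rw [hf0] at this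
    linarith [neg_abs_le (levelFn α u)]
  obtain ⟨t, ⟨ht1, ht2⟩, ht⟩ := intermediate_value_Icc (by linarith : -τ ≤ τ) hcont.continuousOn
    ⟨hneg, hpos⟩
  have htτ : |t| ≤ τ := abs_le.2 ⟨ht1, ht2⟩
  have hτ1 : τ ≤ 1 := by rw [hτ, div_le_one h0]; exact hsmall
  have hv0 : ((Real.exp t : ℝ) : ℂ) * u ≠ 0 :=
    mul_ne_zero (by exact_mod_cast (Real.exp_pos t).ne') hu0
  refine ⟨(Real.exp t : ℝ) * u, ?_, hv0, ht, ?_⟩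
  · have hl := Real.log_nonneg (hw _ (Real.exp_pos t).le)
    have hl2 : Real.log (1 - α) ≤ 0 := Real.log_nonpos (by linarith) (by linarith)
    have ht' : levelFn α ((Real.exp t : ℝ) * u) = 0 := ht
    rw [levelFn] at ht'
    rw [← Real.log_le_log_iff (norm_pos_iff.2 hv0) h0]
    have h3 : 0 ≤ (1 - α) * Real.log ‖1 - ((Real.exp t : ℝ) : ℂ) * u‖ :=
      mul_nonneg (by linarith) hl
    have h4 : (1 - α) * Real.log (1 - α) ≤ 0 := mul_nonpos_of_nonneg_of_nonpos (by linarith) hl2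
    refine le_of_mul_le_mul_left ?_ h0
    linarith
  · have e : u - ((Real.exp t : ℝ) : ℂ) * u = ((-(Real.exp t - 1) : ℝ) : ℂ) * u := by
      push_cast; ring
    rw [e, norm_mul, Complex.norm_real, norm_neg, Real.norm_eq_abs]
    have h2 := Real.abs_exp_sub_one_le (htτ.trans hτ1)
    calc |Real.exp t - 1| * ‖u‖ ≤ (2 * |t|) * 1 := by gcongr
      _ ≤ 2 * τ := by linarith
      _ = _ := by rw [hτ]; ring

/-- A weak form of Pinsker's inequality: the relative entropy of the Bernoulli laws with parameters `α`
and `ρ ≤ α` is at least `(α - ρ)² / 4`. -/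
theorem sq_sub_div_four_le_klDiv {α ρ : ℝ} (hρ : 0 < ρ) (hρα : ρ ≤ α) (hα : α < 1) :
    (α - ρ) ^ 2 / 4 ≤ α * (Real.log α - Real.log ρ) +
      (1 - α) * (Real.log (1 - α) - Real.log (1 - ρ)) := by
  have hα0 : 0 < α := hρ.trans_le hρα
  have hα1 : 0 < 1 - α := by linarith
  have hρ1 : 0 < 1 - ρ := by linarith
  have h1 : Real.log (1 - ρ) - Real.log (1 - α) ≤ (1 - ρ) / (1 - α) - 1 := by
    rw [← Real.log_div hρ1.ne' hα1.ne']
    exact Real.log_le_sub_one_of_pos (by positivity)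
  -- `log x ≤ x - 1` at the square root gains a quadratic term
  set t := √(ρ / α) with ht
  have ht0 : 0 < t := by positivity
  have ht2 : t ^ 2 = ρ / α := Real.sq_sqrt (by positivity)
  have ht1 : t ≤ 1 := by
    rw [ht, Real.sqrt_le_iff, div_le_iff₀ hα0]
    exact ⟨zero_le_one, by linarith⟩
  have h2 : Real.log ρ - Real.log α ≤ 2 * (t - 1) := by
    rw [← Real.log_div hρ.ne' hα0.ne', ← ht2, Real.log_pow]
    have := Real.log_le_sub_one_of_pos ht0
    push_cast
    linarith
  have e : ρ = α * t ^ 2 := by rw [ht2]; field_simp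
  have h3 : (1 - α) * ((1 - ρ) / (1 - α) - 1) = α - ρ := by field_simp; ring
  have h4 : (1 - α) * (Real.log (1 - ρ) - Real.log (1 - α)) ≤ α - ρ := by
    rw [← h3]; gcongr
  have h5 : α * (Real.log ρ - Real.log α) ≤ α * (2 * (t - 1)) := by gcongr
  have h6 : (α - ρ) ^ 2 / 4 ≤ α * (1 - t) ^ 2 := by
    have e2 : (α - ρ) ^ 2 = α ^ 2 * ((1 - t) ^ 2 * (1 + t) ^ 2) := by rw [e]; ring
    rw [e2]
    have a1 : (1 + t) ^ 2 ≤ 4 := by nlinarith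
    have a2 : (1 - t) ^ 2 * (1 + t) ^ 2 ≤ (1 - t) ^ 2 * 4 := by gcongr
    have a3 : α ^ 2 ≤ α := by nlinarith
    calc α ^ 2 * ((1 - t) ^ 2 * (1 + t) ^ 2) / 4 ≤ α ^ 2 * ((1 - t) ^ 2 * 4) / 4 := by gcongr
      _ = α ^ 2 * (1 - t) ^ 2 := by ring
      _ ≤ _ := by gcongr
  have h7 : α * (1 - t) ^ 2 = (ρ - α) - α * (2 * (t - 1)) := by rw [e]; ring
  linarith

/-- Two points `u, v` on the circle of radius `ρ`, on the same side of the real axis: if `ρ - Re v`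
dominates `(α - ρ)²`, then, unless `u` and `v` are far apart, both `α - ρ` and `‖u - α‖` are controlled
by `|Im u + Im v|`, and
`|Im u - Im v| |Im u + Im v| = |Re u - Re v| |Re u + Re v|`. -/
theorem norm_sub_mul_norm_sub_le_of_norm_eq {α ρ ρ₀ C : ℝ} {u v : ℂ} (hρ₀ : 0 < ρ₀) (hρ : ρ₀ ≤ ρ)
    (hρα : ρ ≤ α) (hα : α < 1) (hC : 1 ≤ C) (hu : ‖u‖ = ρ) (hv : ‖v‖ = ρ) (hre : 0 ≤ u.re)
    (him : 0 ≤ u.im * v.im) (hgap : (α - ρ) ^ 2 ≤ C * ρ₀ * (ρ - v.re)) :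
    ‖u - v‖ * ‖u - α‖ ≤ (8 / ρ₀ + 4 * C + 6) * |u.re - v.re| := by
  obtain ⟨x, y⟩ := u
  obtain ⟨a, b⟩ := v
  simp only at hre him hgap ⊢
  have hu2 : x ^ 2 + y ^ 2 = ρ ^ 2 := by
    rw [← hu, Complex.sq_norm, Complex.normSq_apply]; ring
  have hv2 : a ^ 2 + b ^ 2 = ρ ^ 2 := by
    rw [← hv, Complex.sq_norm, Complex.normSq_apply]; ring
  have hρ0 : 0 < ρ := hρ₀.trans_le hρ
  have hsum : |y| + |b| = |y + b| := by
    rcases le_total 0 y with hy | hy <;> rcases le_total 0 b with hb | hb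
    · rw [abs_of_nonneg hy, abs_of_nonneg hb, abs_of_nonneg (by linarith)]
    · have : y * b = 0 := le_antisymm (mul_nonpos_of_nonneg_of_nonpos hy hb) him
      rcases mul_eq_zero.1 this with h | h <;> simp [h]
    · have : y * b = 0 := le_antisymm (mul_nonpos_of_nonpos_of_nonneg hy hb) him
      rcases mul_eq_zero.1 this with h | h <;> simp [h]
    · rw [abs_of_nonpos hy, abs_of_nonpos hb, abs_of_nonpos (by linarith)]; ring
  have hnuv : ‖(⟨x, y⟩ : ℂ) - ⟨a, b⟩‖ ≤ |x - a| + |y - b| := by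
    simpa using Complex.norm_le_abs_re_add_abs_im ((⟨x, y⟩ : ℂ) - ⟨a, b⟩)
  have hnua : ‖(⟨x, y⟩ : ℂ) - α‖ ≤ 2 := by
    refine (norm_sub_le _ _).trans ?_
    rw [hu, Complex.norm_real, Real.norm_of_nonneg (by linarith)]
    linarith
  have hnuv2 : ‖(⟨x, y⟩ : ℂ) - ⟨a, b⟩‖ ≤ 2 := by
    refine (norm_sub_le _ _).trans ?_
    rw [hu, hv]
    linarith
  have haρ : |a| ≤ ρ := abs_le_of_sq_le_sq (by nlinarith [sq_nonneg b]) hρ0.le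
  have hxρ : |x| ≤ ρ := abs_le_of_sq_le_sq (by nlinarith [sq_nonneg y]) hρ0.le
  have hprod : |y - b| * |y + b| ≤ 2 * |x - a| := by
    rw [← abs_mul, show (y - b) * (y + b) = -((x - a) * (x + a)) by linear_combination hu2 - hv2,
      abs_neg, abs_mul, mul_comm]
    gcongr
    exact (abs_add_le x a).trans (by linarith)
  have hxa := abs_nonneg (x - a)
  have hC4 : 0 ≤ 4 * C + 6 := by linarith
  have h8 : 0 ≤ 8 / ρ₀ := by positivity
  -- either the two points are far apart, or `ρ + Re v` is bounded below and `ρ - Re v ≲ (Im v)²`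
  rcases le_or_gt a (-(ρ / 2)) with ha | ha
  · have h1 : ρ₀ / 2 ≤ |x - a| := by
      rw [abs_of_nonneg (by linarith)]; linarith
    calc _ ≤ (2 : ℝ) * 2 := by gcongr
      _ = 8 / ρ₀ * (ρ₀ / 2) := by field_simp; norm_num
      _ ≤ 8 / ρ₀ * |x - a| := by gcongr
      _ ≤ _ := by gcongr; linarith
  · have h1 : ρ - x ≤ |y| := by
      have h2 : 0 ≤ x + |y| := by positivity
      have h3 : ρ ^ 2 ≤ (x + |y|) ^ 2 := by
        rw [← hu2]
        nlinarith [sq_abs y, mul_nonneg hre (abs_nonneg y)]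
      have h4 := abs_le_of_sq_le_sq h3 h2
      rw [abs_of_pos hρ0] at h4
      linarith
    have h2 : ρ₀ * (ρ - a) ≤ 2 * b ^ 2 := by
      have h3 : 0 ≤ ρ - a := by linarith [le_abs_self a]
      have : (ρ - a) * (ρ + a) = b ^ 2 := by linear_combination -hv2
      nlinarith
    have h3 : α - ρ ≤ 2 * C * |b| := by
      refine (le_abs_self _).trans (abs_le_of_sq_le_sq ?_ (by positivity))
      rw [mul_pow, sq_abs]
      have : C ≤ C ^ 2 := by nlinarith
      calc (α - ρ) ^ 2 ≤ C * (ρ₀ * (ρ - a)) := by linarith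
        _ ≤ C * (2 * b ^ 2) := by gcongr
        _ ≤ C ^ 2 * (2 * b ^ 2) := by gcongr
        _ ≤ (2 * C) ^ 2 * b ^ 2 := by nlinarith [sq_nonneg (C * b)]
    have hn : ‖(⟨x, y⟩ : ℂ) - α‖ ≤ (2 * C + 2) * |y + b| := by
      have h4 : ‖(⟨x, y⟩ : ℂ) - α‖ ≤ |x - α| + |y| := by
        simpa using Complex.norm_le_abs_re_add_abs_im ((⟨x, y⟩ : ℂ) - α)
      have h5 : |x - α| ≤ |y| + 2 * C * |b| := by
        rw [abs_sub_comm, abs_of_nonneg (by linarith [le_abs_self x])]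
        linarith
      rw [← hsum]
      nlinarith [abs_nonneg y, abs_nonneg b, mul_nonneg (by linarith : 0 ≤ C) (abs_nonneg y)]
    calc _ ≤ (|x - a| + |y - b|) * ‖(⟨x, y⟩ : ℂ) - α‖ := by gcongr
      _ = |x - a| * ‖(⟨x, y⟩ : ℂ) - α‖ + |y - b| * ‖(⟨x, y⟩ : ℂ) - α‖ := by ring
      _ ≤ |x - a| * 2 + |y - b| * ((2 * C + 2) * |y + b|) := by gcongr
      _ = |x - a| * 2 + (2 * C + 2) * (|y - b| * |y + b|) := by ring
      _ ≤ |x - a| * 2 + (2 * C + 2) * (2 * |x - a|) := by gcongr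
      _ = (4 * C + 6) * |x - a| := by ring
      _ ≤ _ := by gcongr; linarith

theorem exp_le_norm_of_abs_levelFn_le_one {δ α : ℝ} (hδ : 0 < δ) (hα : δ < α) (hα1 : α < 1)
    {u : ℂ} (hu0 : u ≠ 0) (hu1 : u ≠ 1) (hu : ‖u‖ ≤ 1) (hsmall : |levelFn α u| ≤ 1) :
    Real.exp (-(4 / δ)) ≤ ‖u‖ := by
  have h0 : 0 < α := hδ.trans hα
  have h1 : 0 < 1 - α := by linarith
  have hρ0 : 0 < ‖u‖ := norm_pos_iff.2 hu0
  have hw0 : 0 < ‖1 - u‖ := norm_pos_iff.2 (sub_ne_zero.2 hu1.symm)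
  have b1 : α - 1 ≤ α * Real.log α := by
    have := Real.one_sub_inv_le_log_of_pos h0
    calc α - 1 = α * (1 - α⁻¹) := by field_simp
      _ ≤ _ := by gcongr
  have b2 : (1 - α) - 1 ≤ (1 - α) * Real.log (1 - α) := by
    have := Real.one_sub_inv_le_log_of_pos h1
    calc (1 - α) - 1 = (1 - α) * (1 - (1 - α)⁻¹) := by field_simp
      _ ≤ _ := by gcongr
  have b3 : Real.log ‖1 - u‖ ≤ 1 := by
    have h2 : ‖1 - u‖ ≤ 2 := by
      refine (norm_sub_le _ _).trans ?_
      rw [norm_one]; linarith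
    have := Real.log_le_sub_one_of_pos hw0
    linarith
  have b4 : (1 - α) * Real.log ‖1 - u‖ ≤ 1 := by nlinarith
  rw [levelFn] at hsmall
  have b5 : -4 ≤ α * Real.log ‖u‖ := by linarith [(abs_le.1 hsmall).1]
  rw [← Real.le_log_iff_exp_le hρ0]
  have b6 : Real.log ‖u‖ ≤ 0 := Real.log_nonpos hρ0.le hu
  rw [← neg_div, div_le_iff₀ hδ]
  nlinarith

/-- If `√q` is the distance to `1` that a point of the level curve with modulus `ρ` must have, then `√q`
exceeds the least possible distance `1 - ρ` by a quadratic amount in `α - ρ`. -/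
theorem sq_sub_le_of_mul_log_eq {δ α ρ q : ℝ} (hδ : 0 < δ) (hα : δ < 1 - α) (hρ0 : 0 < ρ)
    (hρ : ρ ≤ α) (hq0 : 0 < q) (hq : (1 - α) * Real.log q =
      2 * (α * (Real.log α - Real.log ρ) + (1 - α) * Real.log (1 - α))) :
    δ ^ 2 / 2 * (α - ρ) ^ 2 ≤ q - (1 - ρ) ^ 2 := by
  have hKL := sq_sub_div_four_le_klDiv hρ0 hρ (by linarith)
  have hρ1 : 0 < 1 - ρ := by linarith
  set Λ := Real.log q - 2 * Real.log (1 - ρ) with hΛ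
  have hΛ1 : (α - ρ) ^ 2 / 2 ≤ (1 - α) * Λ := by
    have e : (1 - α) * Λ = 2 * (α * (Real.log α - Real.log ρ) +
        (1 - α) * (Real.log (1 - α) - Real.log (1 - ρ))) := by
      rw [hΛ]; linear_combination hq
    linarith
  have hΛ0 : 0 ≤ Λ := by
    by_contra! hlt
    have := mul_neg_of_pos_of_neg (by linarith : 0 < 1 - α) hlt
    linarith [sq_nonneg (α - ρ)]
  have hΛ2 : (α - ρ) ^ 2 / 2 ≤ Λ := by
    have : (1 - α) * Λ ≤ 1 * Λ := by gcongr; linarith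
    linarith
  have hqe : q = (1 - ρ) ^ 2 * Real.exp Λ := by
    rw [hΛ, Real.exp_sub, Real.exp_log hq0, two_mul, Real.exp_add, Real.exp_log hρ1]
    field_simp
  have h2 := Real.add_one_le_exp Λ
  have h3 : δ ^ 2 ≤ (1 - ρ) ^ 2 := by gcongr; linarith
  rw [hqe]
  calc δ ^ 2 / 2 * (α - ρ) ^ 2 = δ ^ 2 * ((α - ρ) ^ 2 / 2) := by ring
    _ ≤ (1 - ρ) ^ 2 * Λ := by gcongr
    _ ≤ (1 - ρ) ^ 2 * (Real.exp Λ - 1) := by gcongr; linarith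
    _ = _ := by ring

theorem exists_norm_eq_and_norm_one_sub_sq_eq {ρ q : ℝ} (hρ : 0 ≤ ρ) (h1 : (1 - ρ) ^ 2 ≤ q)
    (h2 : q ≤ (1 + ρ) ^ 2) (y : ℝ) : ∃ v : ℂ, ‖v‖ = ρ ∧ ‖1 - v‖ ^ 2 = q ∧
      v.re = (1 + ρ ^ 2 - q) / 2 ∧ 0 ≤ y * v.im := by
  set a := (1 + ρ ^ 2 - q) / 2 with ha
  have haρ : 0 ≤ ρ ^ 2 - a ^ 2 := by
    have a1 : a ≤ ρ := by rw [ha]; linarith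
    have a2 : -ρ ≤ a := by rw [ha]; linarith
    nlinarith
  obtain ⟨b, hb2, hub⟩ : ∃ b : ℝ, b ^ 2 = ρ ^ 2 - a ^ 2 ∧ 0 ≤ y * b := by
    rcases le_total 0 y with hy | hy
    · exact ⟨√(ρ ^ 2 - a ^ 2), Real.sq_sqrt haρ, by positivity⟩
    · exact ⟨-√(ρ ^ 2 - a ^ 2), by rw [neg_sq, Real.sq_sqrt haρ],
        mul_nonneg_of_nonpos_of_nonpos hy (neg_nonpos.2 (Real.sqrt_nonneg _))⟩
  refine ⟨⟨a, b⟩, ?_, ?_, rfl, hub⟩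
  · rw [← sq_eq_sq₀ (norm_nonneg _) hρ, Complex.sq_norm, Complex.normSq_apply]
    linarith
  · rw [Complex.sq_norm, Complex.normSq_apply]
    simp only [Complex.sub_re, Complex.one_re, Complex.sub_im, Complex.one_im]
    rw [ha] at hb2 ⊢
    linear_combination hb2

/-- In the right half-plane the point of the curve close to `u` is found on the circle `‖v‖ = ‖u‖`. -/
theorem exists_levelFn_eq_zero_of_re_nonneg {δ α ρ₀ : ℝ} (hδ : 0 < δ) (hα : δ < α)
    (hα' : α < 1 - δ) {u : ℂ} (hu0 : u ≠ 0) (hu : ‖u‖ ≤ α) (hre : 0 ≤ u.re) (hρ₀ : 0 < ρ₀)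
    (hρ₀1 : ρ₀ ≤ 1) (hρρ₀ : ρ₀ ≤ ‖u‖) (hsmall : |levelFn α u| ≤ δ * ρ₀ / 4) :
    ∃ v : ℂ, ‖v‖ ≤ α ∧ v ≠ 0 ∧ levelFn α v = 0 ∧
      ‖u - v‖ * ‖u - α‖ ≤ (8 / ρ₀ + 4 * (4 / (δ ^ 2 * ρ₀)) + 6) *
        (8 / δ * |levelFn α u|) := by
  have h1δ : δ < 1 - α := by linarith
  have h1 : 0 < 1 - α := hδ.trans h1δ
  have hρ0 : 0 < ‖u‖ := norm_pos_iff.2 hu0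
  have hw : ‖1 - u‖ ^ 2 = 1 - 2 * u.re + ‖u‖ ^ 2 := by
    rw [Complex.sq_norm, Complex.sq_norm, Complex.normSq_apply, Complex.normSq_apply]
    simp
    ring
  have hw0 : 0 < ‖1 - u‖ := by
    have h2 : (1 : ℝ) ≤ ‖1 - u‖ + ‖u‖ := by
      calc (1 : ℝ) = ‖(1 - u) + u‖ := by simp
        _ ≤ _ := norm_add_le _ _
    linarith
  have hhl : levelFn α u = α * Real.log ‖u‖ + (1 - α) * Real.log ‖1 - u‖ -
    (α * Real.log α + (1 - α) * Real.log (1 - α)) := rfl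
  generalize levelFn α u = h at *
  have hδ1 : δ < 1 := by linarith
  -- `√q`, the distance to `1` required of a point of the curve on the circle of radius `‖u‖`, is
  -- `‖1 - u‖ exp (-k / 2)`
  obtain ⟨k, hk⟩ : ∃ k, k = 2 * h / (1 - α) := ⟨_, rfl⟩
  have hkabs : |k| ≤ 2 * |h| / δ := by
    rw [hk, abs_div, abs_mul, abs_of_pos h1, abs_of_pos (two_pos)]
    gcongr
  -- this smallness keeps `q ≤ (1 + ρ)²`, so that the circle does meet the curve
  have hkρ₀ : 2 * |k| ≤ ρ₀ := by
    have : 2 * (2 * |h| / δ) ≤ ρ₀ := by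
      rw [mul_div_assoc', div_le_iff₀ hδ]; linarith
    linarith
  have hexp := Real.abs_exp_sub_one_le (x := -k) (by rw [abs_neg]; linarith)
  rw [abs_neg] at hexp
  obtain ⟨q, hq⟩ : ∃ q, q = ‖1 - u‖ ^ 2 * Real.exp (-k) := ⟨_, rfl⟩
  have hq0 : 0 < q := by rw [hq]; positivity
  have hlogq : Real.log q = 2 * Real.log ‖1 - u‖ - k := by
    rw [hq, Real.log_mul (by positivity) (Real.exp_pos _).ne', Real.log_pow, Real.log_exp]
    push_cast; ring
  have hkmul : (1 - α) * k = 2 * h := by rw [hk]; field_simp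
  have hp4 : ‖1 - u‖ ^ 2 ≤ 1 + ‖u‖ ^ 2 := by rw [hw]; linarith
  have hρ1 : ‖u‖ ^ 2 ≤ 1 := pow_le_one₀ hρ0.le (by linarith)
  have hqup : q ≤ (1 + ‖u‖) ^ 2 := by
    have h2 : Real.exp (-k) ≤ 1 + ρ₀ := by linarith [le_abs_self (Real.exp (-k) - 1)]
    calc q ≤ (1 + ‖u‖ ^ 2) * (1 + ρ₀) := by rw [hq]; gcongr
      _ ≤ (1 + ‖u‖) ^ 2 := by nlinarith
  have hΔ : |‖1 - u‖ ^ 2 - q| ≤ 8 / δ * |h| := by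
    have e : ‖1 - u‖ ^ 2 - q = -(‖1 - u‖ ^ 2 * (Real.exp (-k) - 1)) := by rw [hq]; ring
    rw [e, abs_neg, abs_mul, abs_of_nonneg (by positivity)]
    calc ‖1 - u‖ ^ 2 * |Real.exp (-k) - 1| ≤ 2 * (2 * (2 * |h| / δ)) := by
          gcongr
          · linarith
          · linarith
      _ = _ := by ring
  have hgap := sq_sub_le_of_mul_log_eq hδ h1δ hρ0 hu hq0 (by
    rw [hlogq]; linear_combination -hkmul - 2 * hhl)
  have hqlow : (1 - ‖u‖) ^ 2 ≤ q := by
    have : 0 ≤ δ ^ 2 / 2 * (α - ‖u‖) ^ 2 := by positivity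
    linarith
  obtain ⟨v, hvn, hvw, hvre, hvim⟩ :=
    exists_norm_eq_and_norm_one_sub_sq_eq hρ0.le hqlow hqup u.im
  refine ⟨v, by rw [hvn]; exact hu, ?_, ?_, ?_⟩
  · rw [← norm_pos_iff, hvn]; exact hρ0
  · have : 2 * Real.log ‖1 - v‖ = Real.log q := by
      rw [← hvw, Real.log_pow]; push_cast; ring
    rw [levelFn, hvn]
    linear_combination (1 - α) / 2 * this + (1 - α) / 2 * hlogq - hkmul / 2 - hhl
  · have hdiff : |u.re - v.re| ≤ 8 / δ * |h| := by
      have e : u.re - v.re = -(‖1 - u‖ ^ 2 - q) / 2 := by rw [hw, hvre]; ring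
      rw [e, abs_div, abs_neg, abs_two]
      have := abs_nonneg (‖1 - u‖ ^ 2 - q)
      linarith
    have hC : 1 ≤ 4 / (δ ^ 2 * ρ₀) := by
      rw [le_div_iff₀ (by positivity)]
      have h2 : δ ^ 2 ≤ 1 := pow_le_one₀ hδ.le hδ1.le
      have h3 : δ ^ 2 * ρ₀ ≤ 1 := mul_le_one₀ h2 hρ₀.le hρ₀1
      linarith
    have hgap2 : (α - ‖u‖) ^ 2 ≤ 4 / (δ ^ 2 * ρ₀) * ρ₀ * (‖u‖ - v.re) := by
      have e : 4 / (δ ^ 2 * ρ₀) * ρ₀ * (‖u‖ - v.re) = (q - (1 - ‖u‖) ^ 2) * (2 / δ ^ 2) := by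
        rw [hvre]; field_simp; ring
      rw [e]
      calc (α - ‖u‖) ^ 2 = δ ^ 2 / 2 * (α - ‖u‖) ^ 2 * (2 / δ ^ 2) := by field_simp
        _ ≤ _ := by gcongr
    have hplane := norm_sub_mul_norm_sub_le_of_norm_eq hρ₀ hρρ₀ hu (by linarith) hC rfl hvn
      hre hvim hgap2
    exact hplane.trans (by gcongr)

/-- Stability of the level curve, uniformly in `α`: the product of the distances of `u` to the curve and
to its corner `α` is at most of the order of `levelFn α u`. The inequality `‖u‖ (1 - α) ≤ α ‖1 - u‖`
selects the lobe around `0`; it means `‖z‖ ≤ α / (1 - α)` for `z = u / (1 - u)`. -/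
theorem exists_levelFn_eq_zero_near {δ : ℝ} (hδ : 0 < δ) : ∃ c ε : ℝ, 0 < ε ∧ 0 ≤ c ∧
    ∀ α : ℝ, δ < α → α < 1 - δ → ∀ u : ℂ, u ≠ 0 → ‖u‖ * (1 - α) ≤ α * ‖1 - u‖ →
      |levelFn α u| ≤ ε → ∃ v : ℂ, ‖v‖ ≤ α ∧ v ≠ 0 ∧ levelFn α v = 0 ∧
        ‖u - v‖ * ‖u - α‖ ≤ c * |levelFn α u| := by
  set C₃ := (8 / Real.exp (-(4 / δ)) + 4 * (4 / (δ ^ 2 * Real.exp (-(4 / δ)))) + 6) * (8 / δ)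
    with hC₃
  have hC₃0 : 0 < C₃ := by positivity
  refine ⟨8 + 4 / δ + C₃, δ * Real.exp (-(4 / δ)) / 4, by positivity, by positivity, ?_⟩
  intro α hα hα' u hu0 hratio hsmall
  have h0 : 0 < α := hδ.trans hα
  have hδ1 : δ < 1 := by linarith
  have hexp1 : Real.exp (-(4 / δ)) ≤ 1 := by
    refine Real.exp_le_one_iff.2 ?_
    have : 0 < 4 / δ := by positivity
    linarith
  have hsmall2 : |levelFn α u| ≤ δ / 4 := hsmall.trans (by nlinarith)
  have habs := abs_nonneg (levelFn α u)
  have h4δ : 0 < 4 / δ := by positivity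
  rcases lt_or_ge α ‖u‖ with hu | hu
  · refine ⟨α, ?_, ?_, levelFn_self α h0 (by linarith), ?_⟩
    · rw [Complex.norm_real, Real.norm_of_nonneg h0.le]
    · exact_mod_cast h0.ne'
    · have := norm_sub_sq_le_of_lt_norm h0 (by linarith) hu hratio
        (by linarith [le_abs_self (levelFn α u)])
      rw [← sq]
      nlinarith
  · rcases le_total u.re 0 with hre | hre
    · obtain ⟨v, hv, hv0, hvl, hd⟩ := exists_levelFn_eq_zero_of_re_nonpos h0 (by linarith) hu0
        (by linarith) hre (by linarith)
      refine ⟨v, hv, hv0, hvl, ?_⟩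
      have h2 : ‖u - α‖ ≤ 2 := by
        refine (norm_sub_le _ _).trans ?_
        rw [Complex.norm_real, Real.norm_of_nonneg h0.le]
        linarith
      calc ‖u - v‖ * ‖u - α‖ ≤ (2 / α * |levelFn α u|) * 2 := by gcongr
        _ ≤ (2 / δ * |levelFn α u|) * 2 := by gcongr
        _ = 4 / δ * |levelFn α u| := by ring
        _ ≤ _ := by gcongr; linarith
    · obtain ⟨v, hv, hv0, hvl, hd⟩ := exists_levelFn_eq_zero_of_re_nonneg hδ hα hα' hu0 hu
        hre (Real.exp_pos _) hexp1 (exp_le_norm_of_abs_levelFn_le_one hδ hα (by linarith) hu0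
          (by rintro rfl; rw [norm_one] at hu; linarith) (by linarith) (by linarith)) hsmall
      refine ⟨v, hv, hv0, hvl, hd.trans ?_⟩
      rw [← mul_assoc]
      gcongr
      linarith

/-! ### The zeros and the limit curve -/

theorem curveConst_eq_exp {α : ℝ} (h0 : 0 < α) (h1 : α < 1) :
    curveConst α = Real.exp (α * Real.log α + (1 - α) * Real.log (1 - α)) := by
  rw [curveConst, Real.rpow_def_of_pos h0, Real.rpow_def_of_pos (by linarith), ← Real.exp_add]
  ring_nf

/-- The limit curve is compact, so that the distance to it is attained. -/
theorem isCompact_limitCurve {α : ℝ} (h0 : 0 < α) (h1 : α < 1) : IsCompact (limitCurve α) := by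
  have hK : 0 < curveConst α := by rw [curveConst_eq_exp h0 h1]; exact Real.exp_pos _
  -- cross-multiplied, the equation is continuous also at `z = -1`, where it fails
  have e : limitCurve α = {z : ℂ | ‖z‖ ^ α = curveConst α * ‖1 + z‖} ∩
      {z : ℂ | ‖z‖ ≤ α / (1 - α)} := by
    ext z
    simp only [limitCurve, Set.mem_ofPred_eq, Set.mem_inter_iff]
    refine and_congr_left fun _ => ?_
    by_cases hz : ‖1 + z‖ = 0
    · have hz' : z = -1 := by linear_combination norm_eq_zero.1 hz
      subst hz'
      simp [hK.ne]
    · rw [div_eq_iff hz]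
  refine Metric.isCompact_of_isClosed_isBounded ?_ ?_
  · rw [e]
    refine IsClosed.inter (isClosed_eq ?_ (by fun_prop)) (isClosed_le (by fun_prop) (by fun_prop))
    exact continuous_norm.rpow_const fun _ => Or.inr h0.le
  · refine (Metric.isBounded_closedBall (x := (0 : ℂ)) (r := α / (1 - α))).subset fun z hz => ?_
    simpa using hz.2

theorem div_one_sub_mem_limitCurve {α : ℝ} (h0 : 0 < α) (h1 : α < 1) {v : ℂ} (hv0 : v ≠ 0)
    (hv : ‖v‖ ≤ α) (hl : levelFn α v = 0) : v / (1 - v) ∈ limitCurve α := by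
  have hvp : 0 < ‖v‖ := norm_pos_iff.2 hv0
  have hw : 1 - α ≤ ‖1 - v‖ := by
    have : ‖(1 : ℂ)‖ ≤ ‖1 - v‖ + ‖v‖ := by
      calc ‖(1 : ℂ)‖ = ‖(1 - v) + v‖ := by simp
        _ ≤ _ := norm_add_le _ _
    rw [norm_one] at this
    linarith
  have hw0 : 0 < ‖1 - v‖ := by linarith
  have hwc : 1 - v ≠ 0 := norm_pos_iff.1 hw0
  refine ⟨?_, ?_⟩
  · have e : 1 + v / (1 - v) = 1 / (1 - v) := by field_simp; ring
    rw [e, norm_div, norm_div, norm_one, div_div_eq_mul_div, div_one, curveConst_eq_exp h0 h1,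
      Real.rpow_def_of_pos (by positivity), Real.log_div hvp.ne' hw0.ne']
    conv_lhs => rw [← Real.exp_log hw0]
    rw [Real.log_exp, ← Real.exp_add]
    congr 1
    rw [levelFn] at hl
    linarith
  · rw [norm_div]
    have : 0 < 1 - α := by linarith
    gcongr

theorem abs_levelFn_le_of_binomSection_eq_zero {r n : ℕ} (hr : 0 < r) (hrn : r < n) {z : ℂ}
    (hz : binomSection r n z = 0) :
    |levelFn ((r : ℝ) / n) (z / (1 + z))| ≤ 7 * (Real.log n / n) := by
  obtain ⟨m, hm⟩ := Nat.exists_eq_add_of_lt hrn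
  obtain ⟨h1z, hlow, hup⟩ := norm_pow_div_bounds_of_binomSection_eq_zero hr hm hz
  have hr' : (0 : ℝ) < r := by exact_mod_cast hr
  have hn1 : (1 : ℝ) ≤ n := by exact_mod_cast (by omega : 1 ≤ n)
  have hn0 : (0 : ℝ) < n := by linarith
  have h1z0 : 0 < ‖1 + z‖ := norm_pos_iff.2 h1z
  have hz0 : 0 < ‖z‖ := lt_of_lt_of_le (by positivity)
    (one_div_le_norm_of_binomSection_eq_zero hrn.le (by omega) hz)
  have hα1 : 1 - (r : ℝ) / n = ((m + 1 : ℕ) : ℝ) / n := by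
    rw [hm]; push_cast
    have : (0 : ℝ) < r + m + 1 := by positivity
    field_simp
    ring
  set a : ℝ := (r : ℝ) / n with ha
  set b : ℝ := ((m + 1 : ℕ) : ℝ) / n with hb
  have ha0 : 0 < a := by positivity
  have hb0 : 0 < b := by positivity
  have hlevel : n * levelFn a (z / (1 + z)) =
      Real.log (‖z‖ ^ r / ‖1 + z‖ ^ n) - Real.log (a ^ r * b ^ (m + 1)) := by
    have e : 1 - z / (1 + z) = 1 / (1 + z) := by field_simp; ring
    have e4 : Real.log (‖z‖ ^ r / ‖1 + z‖ ^ n) = r * Real.log ‖z‖ - n * Real.log ‖1 + z‖ := by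
      rw [Real.log_div (by positivity) (by positivity), Real.log_pow, Real.log_pow]
    rw [levelFn, e, norm_div, norm_div, norm_one, Real.log_div hz0.ne' h1z0.ne',
      Real.log_div one_ne_zero h1z0.ne', Real.log_one, e4, hα1,
      Real.log_mul (by positivity) (by positivity), Real.log_pow, Real.log_pow]
    have e1 : (n : ℝ) * a = r := by rw [ha]; field_simp
    have e2 : (n : ℝ) * b = ((m + 1 : ℕ) : ℝ) := by rw [hb]; field_simp
    have e3 : (n : ℝ) = r + ((m + 1 : ℕ) : ℝ) := by rw [hm]; push_cast; ring
    linear_combination (Real.log ‖z‖ - Real.log ‖1 + z‖ - Real.log a) * e1 -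
      (Real.log ‖1 + z‖ + Real.log b) * e2 + Real.log ‖1 + z‖ * e3
  have hl1 := Real.log_le_log (by positivity) hlow
  have hl2 := Real.log_le_log (by positivity) hup
  rw [Real.log_div (by positivity) (by positivity)] at hl1
  rw [Real.log_mul (by positivity) (by positivity), Real.log_pow] at hl2
  have hlog0 : 0 ≤ Real.log n := Real.log_nonneg hn1
  push_cast at hl2
  have habs : |n * levelFn a (z / (1 + z))| ≤ 7 * Real.log n := by
    rw [hlevel, abs_le]
    constructor <;> linarith
  rw [abs_mul, abs_of_pos hn0] at habs
  rw [mul_div_assoc', le_div_iff₀ hn0]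
  linarith

theorem div_natCast_sub_eq {r n : ℕ} (hrn : r < n) :
    (r : ℂ) / ((n : ℂ) - r) = (((r : ℝ) / n : ℝ) : ℂ) / (1 - (((r : ℝ) / n : ℝ) : ℂ)) := by
  have h1 : (n : ℂ) ≠ 0 := by exact_mod_cast (by omega : n ≠ 0)
  have h2 : (n : ℂ) - r ≠ 0 := by
    rw [sub_ne_zero]
    exact_mod_cast hrn.ne'
  have h3 : (1 : ℂ) - r / n ≠ 0 := by
    rw [one_sub_div h1]
    exact div_ne_zero h2 h1
  push_cast
  rw [one_sub_div h1]
  field_simp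

theorem eventually_zeros_near_limitCurve {δ : ℝ} (hδ : 0 < δ) : ∃ c : ℝ,
    ∀ᶠ p : ℕ × ℕ in binomIndexFilter δ, ∀ z : ℂ, binomSection p.1 p.2 z = 0 →
      ∃ ζ ∈ limitCurve ((p.1 : ℝ) / p.2),
        (∀ ξ ∈ limitCurve ((p.1 : ℝ) / p.2), ‖z - ζ‖ ≤ ‖z - ξ‖) ∧
        ‖z - ζ‖ ≤ c / ‖z - (p.1 : ℂ) / ((p.2 : ℂ) - p.1)‖ * (Real.log p.2 / p.2) := by
  obtain ⟨c, ε, hε, hc, H⟩ := exists_levelFn_eq_zero_near hδ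
  have hlim : Tendsto (fun p : ℕ × ℕ => 7 * (Real.log p.2 / p.2)) (binomIndexFilter δ) (𝓝 0) := by
    have h1 : Tendsto (fun x : ℝ => Real.log x / x) atTop (𝓝 0) := by
      simpa using (Real.isLittleO_log_id_atTop).tendsto_div_nhds_zero
    have h2 := (h1.comp (tendsto_natCast_atTop_atTop.comp
      (tendsto_snd_binomIndexFilter δ))).const_mul 7
    rw [mul_zero] at h2
    exact h2
  refine ⟨c * 7 / δ ^ 4, ?_⟩
  filter_upwards [eventually_ratio_mem δ hδ, hlim.eventually (ge_mem_nhds hε)]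
    with ⟨r, n⟩ ⟨hr, hrn, hα, hα'⟩ hn z hz
  simp only at hr hrn hα hα' hn hz ⊢
  have hr' : (0 : ℝ) < r := by exact_mod_cast hr
  have hrn' : (r : ℝ) < n := by exact_mod_cast hrn
  have hn0 : (0 : ℝ) < n := by linarith
  obtain ⟨m, hm⟩ := Nat.exists_eq_add_of_lt hrn
  obtain ⟨h1z, -, -⟩ := norm_pow_div_bounds_of_binomSection_eq_zero hr hm hz
  have h1z0 : 0 < ‖1 + z‖ := norm_pos_iff.2 h1z
  have hlev := abs_levelFn_le_of_binomSection_eq_zero hr hrn hz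
  have hz0 : 0 < ‖z‖ := lt_of_lt_of_le (by positivity)
    (one_div_le_norm_of_binomSection_eq_zero hrn.le (by omega) hz)
  have hzn := norm_le_of_binomSection_eq_zero hr hrn.le hz
  have hz0lt : ‖z‖ < r / (n - r) := lt_of_le_of_lt hzn
    (div_lt_div_of_pos_left hr' (by linarith) (by linarith))
  rw [div_natCast_sub_eq hrn]
  have hz0eq : (r : ℝ) / (n - r) = (r : ℝ) / n / (1 - (r : ℝ) / n) := by
    rw [one_sub_div hn0.ne']
    have : (n : ℝ) - r ≠ 0 := by linarith
    field_simp
  rw [hz0eq] at hz0lt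
  set α : ℝ := (r : ℝ) / n with hαdef
  have h0 : 0 < α := hδ.trans hα
  have h1δ : δ < 1 - α := by linarith
  have h1 : 0 < 1 - α := by linarith
  obtain ⟨u, hu⟩ : ∃ u, u = z / (1 + z) := ⟨_, rfl⟩
  rw [← hu] at hlev
  have h1u : 1 - u = 1 / (1 + z) := by rw [hu]; field_simp; ring
  have hu0 : u ≠ 0 := by rw [hu]; exact div_ne_zero (norm_pos_iff.1 hz0) h1z
  have h1u0 : 1 - u ≠ 0 := by rw [h1u]; exact one_div_ne_zero h1z
  have hzu : z = u / (1 - u) := by rw [h1u, hu]; field_simp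
  have hratio : ‖u‖ * (1 - α) ≤ α * ‖1 - u‖ := by
    rw [h1u, hu, norm_div, norm_div, norm_one, div_mul_eq_mul_div, mul_one_div]
    gcongr
    rw [lt_div_iff₀ h1] at hz0lt
    exact hz0lt.le
  have hw : δ ≤ ‖1 - u‖ := by
    have h3 : (1 : ℝ) ≤ ‖1 - u‖ + ‖u‖ := by
      calc (1 : ℝ) = ‖(1 - u) + u‖ := by simp
        _ ≤ _ := norm_add_le _ _
    nlinarith
  obtain ⟨v, hv, hv0, hvl, hd⟩ := H α hα hα' u hu0 hratio (hlev.trans hn)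
  have hwv : δ ≤ ‖1 - v‖ := by
    have h3 : (1 : ℝ) ≤ ‖1 - v‖ + ‖v‖ := by
      calc (1 : ℝ) = ‖(1 - v) + v‖ := by simp
        _ ≤ _ := norm_add_le _ _
    linarith
  have h1v0 : 1 - v ≠ 0 := norm_pos_iff.1 (by linarith)
  have hmem := div_one_sub_mem_limitCurve h0 (by linarith) hv0 hv hvl
  obtain ⟨ζ, hζ, hmin⟩ := (isCompact_limitCurve h0 (by linarith)).exists_isMinOn ⟨_, hmem⟩
    (f := fun ξ => ‖z - ξ‖) (by fun_prop)
  refine ⟨ζ, hζ, fun ξ hξ => hmin hξ, (hmin hmem).trans ?_⟩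
  have hnα : ‖(1 - (α : ℂ))‖ = 1 - α := by
    rw [← Complex.ofReal_one, ← Complex.ofReal_sub, Complex.norm_real,
      Real.norm_of_nonneg h1.le]
  have h1αc : (1 - (α : ℂ)) ≠ 0 := norm_pos_iff.1 (by rw [hnα]; exact h1)
  have hzz0 : 0 < ‖z - (α : ℂ) / (1 - α)‖ := by
    rw [norm_pos_iff, sub_ne_zero]
    intro h
    rw [h, norm_div, hnα, Complex.norm_real, Real.norm_of_nonneg h0.le] at hz0lt
    exact lt_irrefl _ hz0lt
  simp only
  rw [div_mul_eq_mul_div, le_div_iff₀ hzz0]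
  have e1 : z - v / (1 - v) = (u - v) / ((1 - u) * (1 - v)) := by
    rw [hzu]; field_simp; ring
  have e2 : z - (α : ℂ) / (1 - α) = (u - α) / ((1 - u) * (1 - α)) := by
    rw [hzu]; field_simp; ring
  rw [e1, e2, norm_div, norm_div, norm_mul, norm_mul, hnα]
  calc ‖u - v‖ / (‖1 - u‖ * ‖1 - v‖) * (‖u - α‖ / (‖1 - u‖ * (1 - α)))
      ≤ ‖u - v‖ / (δ * δ) * (‖u - α‖ / (δ * δ)) := by gcongr
    _ = ‖u - v‖ * ‖u - α‖ / δ ^ 4 := by field_simp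
    _ ≤ c * (7 * (Real.log n / n)) / δ ^ 4 := by
        have h3 := hd.trans (mul_le_mul_of_nonneg_left hlev hc)
        gcongr
    _ = c * 7 / δ ^ 4 * (Real.log n / n) := by ring

theorem eventually_exists_zero_near_saddle {δ : ℝ} (hδ : 0 < δ) : ∃ C : ℝ,
    ∀ᶠ p : ℕ × ℕ in binomIndexFilter δ, ∃ z : ℂ, binomSection p.1 p.2 z = 0 ∧
      ‖z - (p.1 : ℂ) / ((p.2 : ℂ) - p.1)‖ ≤ C / √(p.2 : ℝ) := by
  obtain ⟨χ, hχ⟩ := exists_complexErfc_eq_zero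
  refine ⟨1 + √(2 / δ ^ 3) * ‖χ‖, ?_⟩
  filter_upwards [eventually_ratio_mem δ hδ, eventually_exists_zero_near hδ hχ one_pos]
    with ⟨r, n⟩ ⟨hr, hrn, hα, hα'⟩ ⟨z, hz, hd⟩
  simp only at hr hrn hα hα' hz hd ⊢
  refine ⟨z, hz, ?_⟩
  set w : ℂ := (r : ℂ) / ((n : ℂ) - r)
  set σ : ℝ := √(2 * ((r : ℝ) / n) / (1 - (r : ℝ) / n) ^ 3) with hσdef
  have hσ : σ ≤ √(2 / δ ^ 3) := by
    rw [hσdef]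
    apply Real.sqrt_le_sqrt
    have : δ ≤ 1 - (r : ℝ) / n := by linarith
    gcongr
    linarith
  have hσ0 : 0 ≤ σ := Real.sqrt_nonneg _
  have hs : ‖(σ : ℂ) * (χ / (√(n : ℝ) : ℝ))‖ ≤ √(2 / δ ^ 3) * ‖χ‖ / √(n : ℝ) := by
    rw [norm_mul, norm_div, Complex.norm_real, Complex.norm_real,
      Real.norm_of_nonneg hσ0, Real.norm_of_nonneg (Real.sqrt_nonneg _), ← mul_div_assoc]
    gcongr
  calc ‖z - w‖ = ‖(z - (w + (σ : ℂ) * (χ / (√(n : ℝ) : ℝ)))) +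
        (σ : ℂ) * (χ / (√(n : ℝ) : ℝ))‖ := by congr 1; ring
    _ ≤ 1 / √(n : ℝ) + √(2 / δ ^ 3) * ‖χ‖ / √(n : ℝ) := (norm_add_le _ _).trans (add_le_add hd hs)
    _ = _ := by ring

end

theorem theorem3 (δ : ℝ) (hδ0 : 0 < δ) (hδ1 : δ < 1) :
    -- the rate of convergence of the zeros to the curve
    (∃ (c : ℝ) (N : ℕ), ∀ r n : ℕ, N ≤ r → N ≤ n →
      δ < (r : ℝ) / (n : ℝ) → (r : ℝ) / (n : ℝ) < 1 - δ →
      ∀ z : ℂ, binomSection r n z = 0 →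
        ∃ ζ ∈ limitCurve ((r : ℝ) / (n : ℝ)),
          (∀ ξ ∈ limitCurve ((r : ℝ) / (n : ℝ)), ‖z - ζ‖ ≤ ‖z - ξ‖) ∧
          ‖z - ζ‖ ≤ c / ‖z - (r : ℂ) / ((n : ℂ) - (r : ℂ))‖ * (Real.log n / n)) ∧
    -- the zeros come within `O(1 / √n)` of the singular point
    (∃ (C : ℝ) (N : ℕ), ∀ r n : ℕ, N ≤ r → N ≤ n →
      δ < (r : ℝ) / (n : ℝ) → (r : ℝ) / (n : ℝ) < 1 - δ →
      ∃ z : ℂ, binomSection r n z = 0 ∧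
        ‖z - (r : ℂ) / ((n : ℂ) - (r : ℂ))‖ ≤ C / √(n : ℝ)) ∧
    -- the location of these zeros through the zeros of `erfc`, up to `o(1 / √n)`
    (∀ χ : ℂ, complexErfc χ = 0 → ∀ ε : ℝ, 0 < ε → ∃ N : ℕ, ∀ r n : ℕ, N ≤ r → N ≤ n →
      δ < (r : ℝ) / (n : ℝ) → (r : ℝ) / (n : ℝ) < 1 - δ →
      ∃ z : ℂ, binomSection r n z = 0 ∧
        ‖z - ((r : ℂ) / ((n : ℂ) - (r : ℂ)) +
            (√(2 * ((r : ℝ) / (n : ℝ)) / (1 - (r : ℝ) / (n : ℝ)) ^ 3) : ℝ) *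
              (χ / (√(n : ℝ) : ℝ)))‖ ≤ ε / √(n : ℝ)) := by

  refine ⟨?_, ?_, fun χ hχ ε hε => ?_⟩
  · obtain ⟨c, hc⟩ := eventually_zeros_near_limitCurve hδ0
    exact ⟨c, eventually_binomIndexFilter.1 hc⟩
  · obtain ⟨C, hC⟩ := eventually_exists_zero_near_saddle hδ0
    exact ⟨C, eventually_binomIndexFilter.1 hC⟩
  · exact eventually_binomIndexFilter.1 (eventually_exists_zero_near hδ0 hχ hε)
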